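/- Let $\pi:Y\to X$ be a smooth fibre bundle ($X$, $Y$ smooth, Hausdorff, second-countable, connected manifolds, $\dim X=n$) with fibred coordinates $(x^\lambda,y^i)$, let $\omega=dx^1\wedge\cdots\wedge dx^n$, $\omega_\lambda=\partial_\lambda\rfloor\omega$, let $\pi^1_0:J^1Y\to Y$ be the first order jet manifold with coordinates $(x^\lambda,y^i,y^i_\lambda)$, and let $\Pi=\bigwedge^nT^*X\otimes_Y V^*Y\otimes_Y TX$ be the Legendre bundle with coordinates $(x^\lambda,y^i,p^\lambda_i)$. Let $L=\mathcal L\,\omega:J^1Y\to\bigwedge^nT^*X$ be a smooth Lagrangian, $\pi^\lambda_i=\partial^\lambda_i\mathcal L=\partial\mathcal L/\partial y^i_\lambda$, and let $\widehat L:J^1Y\to\Pi$, $p^\lambda_i\circ\widehat L=\pi^\lambda_i$, be its Legendre map. Assume that $L$ is almost regular: $N_L=\widehat L(J^1Y)$ is a closed imbedded subbundle of $\Pi\to Y$, and $\widehat L:J^1Y\to N_L$ is a surjective submersion with connected fibres. Let $\overline s$ be a smooth section of $J^1Y\to X$ which is a solution of the Cartan equations $$\partial_i^\lambda\pi_j^\mu(\widehat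 y_\mu^j-y_\mu^j)=0,\qquad \partial_i\mathcal L-\widehat d_\lambda\pi_i^\lambda+(\widehat y_\lambda^j-y_\lambda^j)\,\partial_i\pi_j^\lambda=0,$$ where $\widehat d_\lambda=\partial_\lambda+\widehat y^i_\lambda\partial_i+y^i_{\lambda\mu}\partial^\mu_i$ and, along $\overline s$, $y^i_\lambda=\overline s^i_\lambda$, $\widehat y^i_\lambda=\partial_\lambda\overline s^i$, $y^i_{\lambda\mu}=\partial_\lambda\overline s^i_\mu$. Let $H$ be a Hamiltonian form on $\Pi$, i.e. $H=p^\lambda_i\,dy^i\wedge\omega_\lambda-\mathcal H\,\omega$ in all fibred coordinates, with smooth local functions $\mathcal H$, and let $\widehat H:\Pi\to J^1Y$, $y^i_\lambda\circ\widehat H=\partial^i_\lambda\mathcal H=\partial\mathcal H/\partial p^\lambda_i$, be its Hamiltonian map. Assume that $H$ is weakly associated with $L$, i.e. the equality $$H=H_{\widehat H}+\widehat H^*L,\qquad H_{\widehat H}=p^\lambda_i\,dy^i\wedge\omega_\lambda-p^\lambda_i\,\widehat H^i_\lambda\,\omega,$$ holds at all points of $N_L$, and that $$\widehat H\circ\widehat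 L\circ\overline s=J^1(\pi^1_0\circ\overline s).$$ Then $r=\widehat L\circ\overline s$ is a smooth section of $\Pi\to X$ and a solution of the covariant Hamilton equations for $H$: along $r$, $$\partial_\lambda r^i=\partial^i_\lambda\mathcal H,\qquad \partial_\lambda r^\lambda_i=-\partial_i\mathcal H .$$ -/

import Mathlib

open Set Manifold
open scoped ContDiff Topology

/-! ## Coordinate spaces -/

/-- The model space `ℝᵏ`. -/
abbrev Rn (k : ℕ) : Type := EuclideanSpace ℝ (Fin k)

/-- Coordinates `((x^λ, y^i), y^i_λ)` of first order jets. -/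
abbrev JetCoord (n m : ℕ) : Type := (Rn n × Rn m) × (Fin m → Fin n → ℝ)

/-- Coordinates `((x^λ, y^i), p^λ_i)` of the Legendre bundle. -/
abbrev LegCoord (n m : ℕ) : Type := (Rn n × Rn m) × (Fin n → Fin m → ℝ)

/-- The coordinate vector `∂_λ` of the model of the base. -/
noncomputable def bvec {n : ℕ} (l : Fin n) : Rn n := EuclideanSpace.single l 1

section Partial
variable {n m : ℕ} {A : Type*} [NormedAddCommGroup A] [NormedSpace ℝ A]

/-- `∂_λ f`, the partial derivative with respect to `x^λ`. -/
noncomputable def dBase (f : (Rn n × Rn m) × A → ℝ) (l : Fin n) (a : (Rn n × Rn m) × A) : ℝ :=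
  fderiv ℝ f a ((bvec l, 0), 0)

/-- `∂_i f`, the partial derivative with respect to `y^i`. -/
noncomputable def dFib (f : (Rn n × Rn m) × A → ℝ) (i : Fin m) (a : (Rn n × Rn m) × A) : ℝ :=
  fderiv ℝ f a ((0, bvec i), 0)

/-- `∂^λ_i f`, the partial derivative with respect to `y^i_λ`. -/
noncomputable def dVel (f : JetCoord n m → ℝ) (l : Fin n) (i : Fin m) (a : JetCoord n m) : ℝ :=
  fderiv ℝ f a ((0, 0), Pi.single i (Pi.single l 1))

/-- `∂^i_λ f`, the partial derivative with respect to `p^λ_i`. -/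
noncomputable def dMom (f : LegCoord n m → ℝ) (i : Fin m) (l : Fin n) (a : LegCoord n m) : ℝ :=
  fderiv ℝ f a ((0, 0), Pi.single l (Pi.single i 1))

end Partial

/-! ## Smooth fibre bundles -/

/-- `π : M → B` is a smooth fibre bundle with typical fibre `T`: it is smooth and smoothly locally
trivial. -/
structure IsSmoothFibreBundle (EB EF : Type*) [NormedAddCommGroup EB] [NormedSpace ℝ EB]
    [NormedAddCommGroup EF] [NormedSpace ℝ EF] {B M : Type*} (T : Type*)
    [TopologicalSpace B] [ChartedSpace EB B] [TopologicalSpace M] [ChartedSpace (EB × EF) M]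
    [TopologicalSpace T] [ChartedSpace EF T] (π : M → B) : Prop where
  smooth : ContMDiff 𝓘(ℝ, EB × EF) 𝓘(ℝ, EB) ∞ π
  locally_trivial : ∀ b : B, ∃ e : Bundle.Trivialization T π, b ∈ e.baseSet ∧
    ContMDiffOn 𝓘(ℝ, EB × EF) (𝓘(ℝ, EB).prod 𝓘(ℝ, EF)) ∞ e e.source ∧
    ContMDiffOn (𝓘(ℝ, EB).prod 𝓘(ℝ, EF)) 𝓘(ℝ, EB × EF) ∞ e.toOpenPartialHomeomorph.symm e.target

section Bundles

variable {n m : ℕ} {X Y : Type*} [TopologicalSpace X] [ChartedSpace (Rn n) X]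
  [TopologicalSpace Y] [ChartedSpace (Rn n × Rn m) Y]

/-- The tangent space `T_x X`. -/
abbrev TB (n : ℕ) {X : Type*} [TopologicalSpace X] [ChartedSpace (Rn n) X] (x : X) : Type :=
  TangentSpace 𝓘(ℝ, Rn n) x

/-- The tangent space `T_y Y`. -/
abbrev TY (n m : ℕ) {Y : Type*} [TopologicalSpace Y] [ChartedSpace (Rn n × Rn m) Y] (y : Y) :
    Type :=
  TangentSpace 𝓘(ℝ, Rn n × Rn m) y

/-- `⋀ⁿ T*_x X`. -/
abbrev Dens (n : ℕ) {X : Type*} [TopologicalSpace X] [ChartedSpace (Rn n) X] (x : X) : Type :=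
  TB n x [⋀^Fin n]→L[ℝ] ℝ

/-- The tangent map `T_y π : T_y Y → T_{π y} X`. -/
noncomputable def dproj (n m : ℕ) {X Y : Type*} [TopologicalSpace X] [ChartedSpace (Rn n) X]
    [TopologicalSpace Y] [ChartedSpace (Rn n × Rn m) Y] (π : Y → X) (y : Y) :
    TY n m y →L[ℝ] TB n (π y) :=
  mfderiv 𝓘(ℝ, Rn n × Rn m) 𝓘(ℝ, Rn n) π y

/-- The fibre of `J¹Y → Y` over `y`: the linear maps `T_{π y} X → T_y Y` that split `T_y π`, that
is, the tangent maps at `π y` of local sections through `y`. -/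
structure JetFibre (n m : ℕ) {X Y : Type*} [TopologicalSpace X] [ChartedSpace (Rn n) X]
    [TopologicalSpace Y] [ChartedSpace (Rn n × Rn m) Y] (π : Y → X) (y : Y) where
  lin : TB n (π y) →L[ℝ] TY n m y
  split : ∀ v, dproj n m π y (lin v) = v

/-- The topology of the affine space `J¹_y Y`. -/
noncomputable instance jetFibreTopology (π : Y → X) (y : Y) : TopologicalSpace (JetFibre n m π y) :=
  TopologicalSpace.induced JetFibre.lin inferInstance

/-- The first order jet manifold `J¹Y` of the bundle `π : Y → X`, as a set of points. -/
structure Jet1 (n m : ℕ) {X Y : Type*} [TopologicalSpace X] [ChartedSpace (Rn n) X]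
    [TopologicalSpace Y] [ChartedSpace (Rn n × Rn m) Y] (π : Y → X) where
  pt : Y
  jet : JetFibre n m π pt

/-- The fibre `T*_{π y} X ⊗ V_y Y`, the linear maps from `T_{π y} X` to the vertical tangent
vectors at `y`. The affine space `J¹_y Y` is modelled over it. -/
noncomputable def VertHom (n m : ℕ) {X Y : Type*} [TopologicalSpace X] [ChartedSpace (Rn n) X]
    [TopologicalSpace Y] [ChartedSpace (Rn n × Rn m) Y] (π : Y → X) (y : Y) :
    Submodule ℝ (TB n (π y) →L[ℝ] TY n m y) where
  carrier := {u | ∀ v, dproj n m π y (u v) = 0}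
  add_mem' := by
    intro a b ha hb v
    simp [ha v, hb v]
  zero_mem' := by intro v; simp
  smul_mem' := by
    intro t a ha v
    simp [ha v]

/-- Translation of a jet by an element of `T*X ⊗ VY`. -/
noncomputable def JetFibre.translate {π : Y → X} {y : Y} (σ : JetFibre n m π y) (u : VertHom n m π y) :
    JetFibre n m π y :=
  ⟨σ.lin + u.1, fun v => by
    have h := u.2 v
    simp [σ.split v, h]⟩

/-- The fibre over `y` of the Legendre bundle `Π = ⋀ⁿT*X ⊗ V*Y ⊗ TX`, written as
`Hom(T*X ⊗ VY, ⋀ⁿT*X)`. -/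
abbrev LegFibre (n m : ℕ) {X Y : Type*} [TopologicalSpace X] [ChartedSpace (Rn n) X]
    [TopologicalSpace Y] [ChartedSpace (Rn n × Rn m) Y] (π : Y → X) (y : Y) : Type :=
  VertHom n m π y →L[ℝ] Dens n (π y)

/-- The Legendre bundle `Π`, as a set of points. -/
structure Legendre (n m : ℕ) {X Y : Type*} [TopologicalSpace X] [ChartedSpace (Rn n) X]
    [TopologicalSpace Y] [ChartedSpace (Rn n × Rn m) Y] (π : Y → X) where
  pt : Y
  mom : LegFibre n m π pt

/-! ## Fibred coordinates -/

/-- Fibred coordinates `(x^λ, y^i)` on `Y`: a smooth chart of `Y` whose first `n` coordinates are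
the pullbacks of those of a smooth chart of `X`. -/
structure FibredChart (n m : ℕ) {X Y : Type*} [TopologicalSpace X] [ChartedSpace (Rn n) X]
    [TopologicalSpace Y] [ChartedSpace (Rn n × Rn m) Y] (π : Y → X) where
  base : OpenPartialHomeomorph X (Rn n)
  total : OpenPartialHomeomorph Y (Rn n × Rn m)
  base_mem : base ∈ IsManifold.maximalAtlas 𝓘(ℝ, Rn n) ∞ X
  total_mem : total ∈ IsManifold.maximalAtlas 𝓘(ℝ, Rn n × Rn m) ∞ Y
  proj_mem : ∀ y ∈ total.source, π y ∈ base.source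
  proj_eq : ∀ y ∈ total.source, base (π y) = (total y).1

namespace FibredChart

variable {π : Y → X} (c : FibredChart n m π)

/-- `(dx^λ)` as a map `T_x X → ℝⁿ`. -/
noncomputable def dX (x : X) : TB n x →L[ℝ] Rn n :=
  mfderiv 𝓘(ℝ, Rn n) 𝓘(ℝ, Rn n) c.base x

/-- `(dx^λ, dy^i)` as a map `T_y Y → ℝⁿ × ℝᵐ`. -/
noncomputable def dY (y : Y) : TY n m y →L[ℝ] Rn n × Rn m :=
  mfderiv 𝓘(ℝ, Rn n × Rn m) 𝓘(ℝ, Rn n × Rn m) c.total y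

/-- The coordinate vectors `∂_λ` of `T_x X`. -/
noncomputable def baseFrame (x : X) (l : Fin n) : TB n x := (c.dX x).inverse (bvec l)

/-- The vertical coordinate vectors `∂_i` of `T_y Y`. -/
noncomputable def fibFrame (y : Y) (i : Fin m) : TY n m y := (c.dY y).inverse (0, bvec i)

/-- The jet coordinates `y^i_λ`. -/
noncomputable def vel {y : Y} (σ : JetFibre n m π y) : Fin m → Fin n → ℝ :=
  fun i l => (c.dY y (σ.lin (c.baseFrame (π y) l))).2 i

/-- The linear map `dx^λ ⊗ ∂_i : T_{π y} X → T_y Y`. -/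
noncomputable def tensor (y : Y) (l : Fin n) (i : Fin m) : TB n (π y) →L[ℝ] TY n m y :=
  ((EuclideanSpace.proj l : Rn n →L[ℝ] ℝ).comp (c.dX (π y))).smulRight (c.fibFrame y i)

open Classical in
/-- `dx^λ ⊗ ∂_i` as an element of `T*X ⊗ VY`, over the domain of the chart. -/
noncomputable def vertBasis (y : Y) (l : Fin n) (i : Fin m) : VertHom n m π y :=
  if h : c.tensor y l i ∈ VertHom n m π y then ⟨c.tensor y l i, h⟩ else 0

/-- The momentum coordinates `p^λ_i`, so that `q = p^λ_i ω ⊗ dy^i ⊗ ∂_λ`. -/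
noncomputable def momenta {y : Y} (q : LegFibre n m π y) : Fin n → Fin m → ℝ :=
  fun l i => q (c.vertBasis y l i) (c.baseFrame (π y))

/-- The coordinates of a jet. -/
noncomputable def jetCoord (z : Jet1 n m π) : JetCoord n m := (c.total z.pt, c.vel z.jet)

/-- The coordinates of a point of the Legendre bundle. -/
noncomputable def legCoord (q : Legendre n m π) : LegCoord n m := (c.total q.pt, c.momenta q.mom)

/-- The open set of the coordinates of all jets over the domain of the chart. -/
def jetDom : Set (JetCoord n m) := c.total.target ×ˢ univ

/-- The open set of the coordinates of all points of `Π` over the domain of the chart. -/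
def legDom : Set (LegCoord n m) := c.total.target ×ˢ univ

/-- The form `ω = dx^1 ∧ ⋯ ∧ dx^n` on `Y`. -/
noncomputable def vol {y : Y} (w : Fin n → TY n m y) : ℝ :=
  Matrix.det (Matrix.of fun (l k : Fin n) => (c.dY y (w k)).1 l)

/-- The form `dy^i ∧ ω_λ` on `Y`, which is `dx^1 ∧ ⋯ ∧ dx^n` with `dx^λ` replaced by `dy^i`. -/
noncomputable def volAt {y : Y} (l : Fin n) (i : Fin m) (w : Fin n → TY n m y) : ℝ :=
  Matrix.det (Matrix.updateRow (Matrix.of fun (l k : Fin n) => (c.dY y (w k)).1 l) l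
    (fun k => (c.dY y (w k)).2 i))

/-- The form `p^λ_i dy^i ∧ ω_λ` at a point of `Π`. -/
noncomputable def taut {y : Y} (q : LegFibre n m π y) (w : Fin n → TY n m y) : ℝ :=
  ∑ l, ∑ i, c.momenta q l i * c.volAt l i w

/-- The form `p^λ_i dy^i ∧ ω_λ - p^λ_i Φ^i_λ ω` at a point of `Π`, where `Φ` is a jet at that
point. -/
noncomputable def formOfJet {y : Y} (q : LegFibre n m π y) (Φ : JetFibre n m π y)
    (w : Fin n → TY n m y) : ℝ :=
  c.taut q w - (∑ l, ∑ i, c.momenta q l i * c.vel Φ i l) * c.vol w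

end FibredChart

/-- The topology of `Π`: the coordinates are homeomorphisms from open sets onto open sets. -/
instance legendreTopology (π : Y → X) : TopologicalSpace (Legendre n m π) :=
  TopologicalSpace.generateFrom
    {S | ∃ (c : FibredChart n m π) (O : Set (LegCoord n m)), IsOpen O ∧
      S = {q | q.pt ∈ c.total.source ∧ c.legCoord q ∈ O}}

end Bundles

section Charts

variable {n m : ℕ} {X Y : Type*} [TopologicalSpace X] [ChartedSpace (Rn n) X]
  [TopologicalSpace Y] [ChartedSpace (Rn n × Rn m) Y]

/-- Around every point of a smooth fibre bundle there are fibred coordinates. -/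
theorem IsSmoothFibreBundle.exists_fibredChart [IsManifold 𝓘(ℝ, Rn n) ∞ X]
    [IsManifold 𝓘(ℝ, Rn n × Rn m) ∞ Y] {T : Type*} [TopologicalSpace T] [ChartedSpace (Rn m) T]
    [IsManifold 𝓘(ℝ, Rn m) ∞ T] {π : Y → X} (hπ : IsSmoothFibreBundle (Rn n) (Rn m) T π) (y : Y) :
    ∃ c : FibredChart n m π, y ∈ c.total.source := by
  obtain ⟨e, he, h1, h2⟩ := hπ.locally_trivial (π y)
  have hy : y ∈ e.source := by rw [e.mem_source]; exact he
  set b := chartAt (Rn n) (π y)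
  set f := chartAt (Rn m) (e y).2
  have hb : b ∈ IsManifold.maximalAtlas 𝓘(ℝ, Rn n) ∞ X := IsManifold.chart_mem_maximalAtlas _
  have hf : f ∈ IsManifold.maximalAtlas 𝓘(ℝ, Rn m) ∞ T := IsManifold.chart_mem_maximalAtlas _
  have g1 : ContMDiffOn (𝓘(ℝ, Rn n).prod 𝓘(ℝ, Rn m)) 𝓘(ℝ, Rn n × Rn m) ∞
      (b.prod f) (b.prod f).source := by
    have := (contMDiffOn_of_mem_maximalAtlas hb).prodMap (contMDiffOn_of_mem_maximalAtlas hf)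
    rw [modelWithCornersSelf_prod, ← chartedSpaceSelf_prod]
    exact this
  have g2 : ContMDiffOn 𝓘(ℝ, Rn n × Rn m) (𝓘(ℝ, Rn n).prod 𝓘(ℝ, Rn m)) ∞
      (b.prod f).symm (b.prod f).target := by
    have := (contMDiffOn_symm_of_mem_maximalAtlas hb).prodMap
      (contMDiffOn_symm_of_mem_maximalAtlas hf)
    rw [modelWithCornersSelf_prod, ← chartedSpaceSelf_prod]
    exact this
  refine ⟨⟨b, e.toOpenPartialHomeomorph.trans (b.prod f), hb, ?_, ?_, ?_⟩, ?_⟩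
  · apply OpenPartialHomeomorph.mem_maximalAtlas_of_contMDiffOn
    · refine g1.comp (h1.mono ?_) ?_
      · intro z hz; exact hz.1
      · intro z hz; exact hz.2
    · refine h2.comp (g2.mono ?_) ?_
      · intro z hz; exact hz.1
      · intro z hz; exact hz.2
  · intro z hz
    have h := hz.2.1
    have h' := e.proj_toFun z hz.1
    rw [← h']
    exact h
  · intro z hz
    have h' := e.proj_toFun z hz.1
    rw [← h']
    rfl
  · refine ⟨hy, ?_, mem_chart_source _ _⟩
    have h' := e.proj_toFun y hy
    change (e.toOpenPartialHomeomorph y).1 ∈ b.source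
    rw [h']
    exact mem_chart_source _ _

namespace FibredChart

variable {π : Y → X} (c : FibredChart n m π)

theorem dX_isInvertible {x : X} (hx : x ∈ c.base.source) : (c.dX x).IsInvertible := by
  have h : c.base.MDifferentiable 𝓘(ℝ, Rn n) 𝓘(ℝ, Rn n) :=
    ⟨(contMDiffOn_of_mem_maximalAtlas c.base_mem).mdifferentiableOn (by simp),
      (contMDiffOn_symm_of_mem_maximalAtlas c.base_mem).mdifferentiableOn (by simp)⟩
  exact ⟨h.mfderiv hx, rfl⟩

theorem dY_isInvertible {y : Y} (hy : y ∈ c.total.source) : (c.dY y).IsInvertible := by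
  have h : c.total.MDifferentiable 𝓘(ℝ, Rn n × Rn m) 𝓘(ℝ, Rn n × Rn m) :=
    ⟨(contMDiffOn_of_mem_maximalAtlas c.total_mem).mdifferentiableOn (by simp),
      (contMDiffOn_symm_of_mem_maximalAtlas c.total_mem).mdifferentiableOn (by simp)⟩
  exact ⟨h.mfderiv hy, rfl⟩

/-- `dx^λ ∘ Tπ = dx^λ`. -/
theorem dX_dproj (hπ : ContMDiff 𝓘(ℝ, Rn n × Rn m) 𝓘(ℝ, Rn n) ∞ π) {y : Y}
    (hy : y ∈ c.total.source) (w : TY n m y) : c.dX (π y) (dproj n m π y w) = (c.dY y w).1 := by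
  have h1 : HasMFDerivAt 𝓘(ℝ, Rn n × Rn m) 𝓘(ℝ, Rn n) (c.base ∘ π) y
      ((c.dX (π y)).comp (dproj n m π y)) := by
    refine HasMFDerivAt.comp y ?_ ?_
    · exact ((contMDiffAt_of_mem_maximalAtlas c.base_mem (c.proj_mem y hy)).mdifferentiableAt
        (by simp)).hasMFDerivAt
    · exact (hπ.mdifferentiable (by simp) y).hasMFDerivAt
  have h2 : HasMFDerivAt 𝓘(ℝ, Rn n × Rn m) 𝓘(ℝ, Rn n) (Prod.fst ∘ c.total) y
      ((ContinuousLinearMap.fst ℝ (Rn n) (Rn m)).comp (c.dY y)) := by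
    refine HasMFDerivAt.comp (I' := 𝓘(ℝ, Rn n × Rn m)) y ?_ ?_
    · exact (ContinuousLinearMap.fst ℝ (Rn n) (Rn m)).hasFDerivAt.hasMFDerivAt
    · exact ((contMDiffAt_of_mem_maximalAtlas c.total_mem hy).mdifferentiableAt
        (by simp)).hasMFDerivAt
  have h3 : c.base ∘ π =ᶠ[𝓝 y] Prod.fst ∘ c.total := by
    filter_upwards [c.total.open_source.mem_nhds hy] with z hz
    exact c.proj_eq z hz
  have h4 := hasMFDerivAt_unique h1 (h2.congr_of_eventuallyEq h3)
  exact DFunLike.congr_fun h4 w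

theorem dX_inverse {x : X} (hx : x ∈ c.base.source) (e : Rn n) :
    c.dX x ((c.dX x).inverse e) = e := (c.dX_isInvertible hx).self_apply_inverse e

theorem inverse_dX {x : X} (hx : x ∈ c.base.source) (v : TB n x) :
    (c.dX x).inverse (c.dX x v) = v := (c.dX_isInvertible hx).inverse_apply_self v

theorem dY_inverse {y : Y} (hy : y ∈ c.total.source) (e : Rn n × Rn m) :
    c.dY y ((c.dY y).inverse e) = e := (c.dY_isInvertible hy).self_apply_inverse e

theorem inverse_dY {y : Y} (hy : y ∈ c.total.source) (v : TY n m y) :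
    (c.dY y).inverse (c.dY y v) = v := (c.dY_isInvertible hy).inverse_apply_self v

theorem dX_baseFrame {x : X} (hx : x ∈ c.base.source) (l : Fin n) :
    c.dX x (c.baseFrame x l) = bvec l := c.dX_inverse hx _

theorem dY_injective {y : Y} (hy : y ∈ c.total.source) : Function.Injective (c.dY y) :=
  Function.LeftInverse.injective (c.inverse_dY hy)

theorem dX_injective {x : X} (hx : x ∈ c.base.source) : Function.Injective (c.dX x) :=
  Function.LeftInverse.injective (c.inverse_dX hx)

theorem tensor_apply (y : Y) (l : Fin n) (i : Fin m) (v : TB n (π y)) :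
    c.tensor y l i v = (c.dX (π y) v) l • c.fibFrame y i := rfl

theorem tensor_mem (hπ : ContMDiff 𝓘(ℝ, Rn n × Rn m) 𝓘(ℝ, Rn n) ∞ π) {y : Y}
    (hy : y ∈ c.total.source) (l : Fin n) (i : Fin m) : c.tensor y l i ∈ VertHom n m π y := by
  intro v
  apply c.dX_injective (c.proj_mem y hy)
  rw [c.dX_dproj hπ hy, tensor_apply, map_smul, fibFrame, c.dY_inverse hy]
  simp

theorem coe_vertBasis (hπ : ContMDiff 𝓘(ℝ, Rn n × Rn m) 𝓘(ℝ, Rn n) ∞ π) {y : Y}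
    (hy : y ∈ c.total.source) (l : Fin n) (i : Fin m) :
    (c.vertBasis y l i : TB n (π y) →L[ℝ] TY n m y) = c.tensor y l i := by
  rw [vertBasis, dif_pos (c.tensor_mem hπ hy l i)]

/-- The jet with given coordinates `y^i_λ`. -/
noncomputable def jetOf (hπ : ContMDiff 𝓘(ℝ, Rn n × Rn m) 𝓘(ℝ, Rn n) ∞ π) {y : Y}
    (hy : y ∈ c.total.source) (v : Fin m → Fin n → ℝ) : JetFibre n m π y :=
  ⟨((c.dY y).inverse.comp (ContinuousLinearMap.inl ℝ (Rn n) (Rn m))).comp (c.dX (π y)) +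
    ∑ i, ∑ l, v i l • c.tensor y l i, fun e => by
      have h : ∀ i l, dproj n m π y (c.tensor y l i e) = 0 :=
        fun i l => c.tensor_mem hπ hy l i e
      apply c.dX_injective (c.proj_mem y hy)
      simp only [add_apply, sum_apply, smul_apply, map_add, map_sum, map_smul, h]
      simp [c.dX_dproj hπ hy, c.dY_inverse hy]⟩

theorem vel_jetOf (hπ : ContMDiff 𝓘(ℝ, Rn n × Rn m) 𝓘(ℝ, Rn n) ∞ π) {y : Y}
    (hy : y ∈ c.total.source) (v : Fin m → Fin n → ℝ) : c.vel (c.jetOf hπ hy v) = v := by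
  funext i l
  have h := c.dX_baseFrame (c.proj_mem y hy) l
  simp [vel, jetOf, tensor_apply, h, fibFrame, c.dY_inverse hy, bvec, PiLp.single_apply,
    Prod.snd_sum, WithLp.ofLp_sum, Finset.sum_apply, Pi.single_apply]

theorem sum_baseFrame {x : X} (hx : x ∈ c.base.source) (v : TB n x) :
    v = ∑ l, (c.dX x v) l • c.baseFrame x l := by
  apply c.dX_injective hx
  ext k
  simp only [map_sum, map_smul, c.dX_baseFrame hx]
  simp [bvec, WithLp.ofLp_sum, Pi.single_apply]

/-- A jet is determined by its coordinates. -/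
theorem jet_ext (hπ : ContMDiff 𝓘(ℝ, Rn n × Rn m) 𝓘(ℝ, Rn n) ∞ π) {y : Y}
    (hy : y ∈ c.total.source) {σ τ : JetFibre n m π y} (h : c.vel σ = c.vel τ) : σ = τ := by
  have hb : ∀ l, σ.lin (c.baseFrame (π y) l) = τ.lin (c.baseFrame (π y) l) := by
    intro l
    apply c.dY_injective hy
    refine Prod.ext ?_ ?_
    · rw [← c.dX_dproj hπ hy, ← c.dX_dproj hπ hy, σ.split, τ.split]
    · ext i
      exact congrFun (congrFun h i) l
  obtain ⟨a, ha⟩ := σ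
  obtain ⟨b, hb'⟩ := τ
  congr 1
  ext1 v
  rw [c.sum_baseFrame (c.proj_mem y hy) v]
  simp only [map_sum, map_smul]
  exact Finset.sum_congr rfl fun l _ => congrArg _ (hb l)

/-- The basis `∂_λ` of `T_x X`. -/
theorem exists_basis {x : X} (hx : x ∈ c.base.source) :
    ∃ b : Module.Basis (Fin n) ℝ (TB n x), ⇑b = c.baseFrame x := by
  obtain ⟨A, hA⟩ := c.dX_isInvertible hx
  refine ⟨(EuclideanSpace.basisFun (Fin n) ℝ).toBasis.map A.symm.toLinearEquiv, ?_⟩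
  funext l
  apply c.dX_injective hx
  rw [c.dX_baseFrame hx, ← hA]
  simp [bvec]

theorem vol_jet (hπ : ContMDiff 𝓘(ℝ, Rn n × Rn m) 𝓘(ℝ, Rn n) ∞ π) {y : Y}
    (hy : y ∈ c.total.source) (σ : JetFibre n m π y) :
    c.vol (fun k => σ.lin (c.baseFrame (π y) k)) = 1 := by
  rw [vol]
  have h1 : (Matrix.of fun (l k : Fin n) => (c.dY y (σ.lin (c.baseFrame (π y) k))).1 l) = 1 := ?_
  · rw [h1, Matrix.det_one]
  ext l k
  rw [Matrix.of_apply, ← c.dX_dproj hπ hy, σ.split, c.dX_baseFrame (c.proj_mem y hy)]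
  simp [bvec, Matrix.one_apply]

theorem volAt_jet (hπ : ContMDiff 𝓘(ℝ, Rn n × Rn m) 𝓘(ℝ, Rn n) ∞ π) {y : Y}
    (hy : y ∈ c.total.source) (σ : JetFibre n m π y) (l : Fin n) (i : Fin m) :
    c.volAt l i (fun k => σ.lin (c.baseFrame (π y) k)) = c.vel σ i l := by
  have h1 : (Matrix.of fun (l k : Fin n) => (c.dY y (σ.lin (c.baseFrame (π y) k))).1 l) = 1 := by
    ext l k
    rw [Matrix.of_apply, ← c.dX_dproj hπ hy, σ.split, c.dX_baseFrame (c.proj_mem y hy)]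
    simp [bvec, Matrix.one_apply]
  rw [volAt, h1, ← Matrix.det_transpose, ← Matrix.updateCol_transpose, Matrix.transpose_one,
    ← Matrix.cramer_apply, Matrix.cramer_one]
  rfl

/-- The form `p^λ_i dy^i ∧ ω_λ`, pulled back by a jet, is `p^λ_i y^i_λ ω`. -/
theorem taut_jet (hπ : ContMDiff 𝓘(ℝ, Rn n × Rn m) 𝓘(ℝ, Rn n) ∞ π) {y : Y}
    (hy : y ∈ c.total.source) (q : LegFibre n m π y) (σ : JetFibre n m π y) :
    c.taut q (fun k => σ.lin (c.baseFrame (π y) k)) =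
      ∑ l, ∑ i, c.momenta q l i * c.vel σ i l := by
  simp only [taut, c.volAt_jet hπ hy]

/-- The density `ω`. -/
noncomputable def dens (x : X) : Dens n x where
  toFun w := Matrix.det (Matrix.of fun (k l : Fin n) => (c.dX x (w k)) l)
  map_update_add' := by
    intro inst w k a b
    have : inst = instDecidableEqFin n := Subsingleton.elim _ _
    subst this
    have h : ∀ a, (Matrix.of fun (k' l : Fin n) => (c.dX x (Function.update w k a k')) l) =
        Matrix.updateRow (Matrix.of fun (k l : Fin n) => (c.dX x (w k)) l) k
          (fun l => c.dX x a l) := by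
      intro a
      ext k' l
      by_cases hk : k' = k
      · subst hk; simp
      · simp [hk]
    simp only [h, map_add]
    exact Matrix.det_updateRow_add _ _ _ _
  map_update_smul' := by
    intro inst w k t a
    have : inst = instDecidableEqFin n := Subsingleton.elim _ _
    subst this
    have h : ∀ a, (Matrix.of fun (k' l : Fin n) => (c.dX x (Function.update w k a k')) l) =
        Matrix.updateRow (Matrix.of fun (k l : Fin n) => (c.dX x (w k)) l) k
          (fun l => c.dX x a l) := by
      intro a
      ext k' l
      by_cases hk : k' = k
      · subst hk; simp
      · simp [hk]
    simp only [h, map_smul]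
    exact Matrix.det_updateRow_smul _ _ _ _
  cont := by
    apply Continuous.matrix_det
    refine continuous_matrix fun k l => ?_
    exact (EuclideanSpace.proj l : Rn n →L[ℝ] ℝ).continuous.comp
      ((c.dX x).continuous.comp (continuous_apply k))
  map_eq_zero_of_eq' := by
    intro w a b hab hne
    refine Matrix.det_zero_of_row_eq hne ?_
    ext l
    simp [hab]

theorem dens_baseFrame {x : X} (hx : x ∈ c.base.source) : c.dens x (c.baseFrame x) = 1 := by
  change Matrix.det (Matrix.of fun (k l : Fin n) => (c.dX x (c.baseFrame x k)) l) = 1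
  have h1 : (Matrix.of fun (k l : Fin n) => (c.dX x (c.baseFrame x k)) l) = 1 := ?_
  · rw [h1, Matrix.det_one]
  ext k l
  simp [c.dX_baseFrame hx, bvec, Matrix.one_apply, PiLp.single_apply, eq_comm]

/-- A density is determined by its coordinate. -/
theorem dens_eq {x : X} (hx : x ∈ c.base.source) (D : Dens n x) :
    D = D (c.baseFrame x) • c.dens x := by
  obtain ⟨b, hb⟩ := c.exists_basis hx
  have h1 := D.toAlternatingMap.eq_smul_basis_det b
  have h2 := (c.dens x).toAlternatingMap.eq_smul_basis_det b
  rw [hb] at h1 h2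
  ext w
  have h3 := DFunLike.congr_fun h1 w
  have h4 := DFunLike.congr_fun h2 w
  have h5 := c.dens_baseFrame hx
  simp only [AlternatingMap.smul_apply, ContinuousAlternatingMap.coe_toAlternatingMap,
    smul_eq_mul] at h3 h4
  rw [h5, one_mul] at h4
  rw [h3, ContinuousAlternatingMap.smul_apply, h4, smul_eq_mul]

/-- The coordinates of an element of `T*X ⊗ VY`. -/
noncomputable def vertCoord (y : Y) : VertHom n m π y →L[ℝ] (Fin m → Fin n → ℝ) :=
  { toFun u := fun i l => (c.dY y (u.1 (c.baseFrame (π y) l))).2 i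
    map_add' := by intro u v; ext; simp
    map_smul' := by intro t u; ext; simp
    cont := by
      refine continuous_pi fun i => continuous_pi fun l => ?_
      have h1 : Continuous fun u : VertHom n m π y => u.1 (c.baseFrame (π y) l) :=
        (continuous_eval_const (c.baseFrame (π y) l)).comp continuous_subtype_val
      exact (((EuclideanSpace.proj i : Rn m →L[ℝ] ℝ).comp
        (ContinuousLinearMap.snd ℝ (Rn n) (Rn m))).continuous.comp (c.dY y).continuous).comp h1 }

theorem vertCoord_apply {y : Y} (u : VertHom n m π y) (i : Fin m) (l : Fin n) :
    c.vertCoord y u i l = (c.dY y (u.1 (c.baseFrame (π y) l))).2 i := rfl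

theorem vel_translate {y : Y} (σ : JetFibre n m π y) (u : VertHom n m π y) :
    c.vel (σ.translate u) = c.vel σ + c.vertCoord y u := by
  funext i l
  simp [vel, JetFibre.translate, vertCoord_apply]

theorem vertCoord_vertBasis (hπ : ContMDiff 𝓘(ℝ, Rn n × Rn m) 𝓘(ℝ, Rn n) ∞ π) {y : Y}
    (hy : y ∈ c.total.source) (l : Fin n) (i : Fin m) :
    c.vertCoord y (c.vertBasis y l i) = Pi.single i (Pi.single l 1) := by
  funext j k
  have h := c.dX_baseFrame (c.proj_mem y hy) k
  rw [vertCoord_apply, c.coe_vertBasis hπ hy, tensor_apply, h, map_smul, fibFrame,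
    c.dY_inverse hy]
  by_cases hj : j = i
  · subst hj
    simp [bvec, Pi.single_apply, eq_comm]
    split_ifs <;> simp
  · simp [bvec, hj]
    split_ifs <;> simp [hj]

/-- There is a point of `Π` over `y` with given coordinates `p^λ_i`. -/
theorem exists_momenta (hπ : ContMDiff 𝓘(ℝ, Rn n × Rn m) 𝓘(ℝ, Rn n) ∞ π) {y : Y}
    (hy : y ∈ c.total.source) (p : Fin n → Fin m → ℝ) :
    ∃ q : LegFibre n m π y, c.momenta q = p := by
  refine ⟨(∑ l, ∑ i, p l i • (ContinuousLinearMap.proj (R := ℝ) l).comp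
    ((ContinuousLinearMap.proj i).comp (c.vertCoord y))).smulRight (c.dens (π y)), ?_⟩
  funext l i
  simp [momenta, c.dens_baseFrame (c.proj_mem y hy), c.vertCoord_vertBasis hπ hy, Pi.single_apply,
    ite_apply]

end FibredChart
end Charts

section Mechanics

variable {n m : ℕ} {X Y : Type*} [TopologicalSpace X] [ChartedSpace (Rn n) X]
  [TopologicalSpace Y] [ChartedSpace (Rn n × Rn m) Y] {π : Y → X}

/-! ## Lagrangians and the Legendre map -/

/-- A first order Lagrangian `L : J¹Y → ⋀ⁿT*X`, a smooth morphism over `X`. In fibred coordinates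
`L = 𝓛 ω`. -/
structure Lagrangian (n m : ℕ) {X Y : Type*} [TopologicalSpace X] [ChartedSpace (Rn n) X]
    [TopologicalSpace Y] [ChartedSpace (Rn n × Rn m) Y] (π : Y → X) where
  toDens : ∀ y : Y, JetFibre n m π y → Dens n (π y)
  smooth : ∀ c : FibredChart n m π, ∃ l : JetCoord n m → ℝ, ContDiffOn ℝ ∞ l c.jetDom ∧
    ∀ z : Jet1 n m π, z.pt ∈ c.total.source →
      toDens z.pt z.jet (c.baseFrame (π z.pt)) = l (c.jetCoord z)

namespace Lagrangian

variable (L : Lagrangian n m π)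

/-- The coordinate expression `𝓛` of a Lagrangian. On `c.jetDom` it is uniquely determined. -/
noncomputable def loc (c : FibredChart n m π) : JetCoord n m → ℝ := (L.smooth c).choose

theorem loc_contDiffOn (c : FibredChart n m π) : ContDiffOn ℝ ∞ (L.loc c) c.jetDom :=
  (L.smooth c).choose_spec.1

theorem loc_jetCoord (c : FibredChart n m π) (z : Jet1 n m π) (hz : z.pt ∈ c.total.source) :
    L.toDens z.pt z.jet (c.baseFrame (π z.pt)) = L.loc c (c.jetCoord z) :=
  (L.smooth c).choose_spec.2 z hz

/-- The Legendre map `L̂ : J¹Y → Π`, the fibre derivative of `L` on the affine spaces `J¹_y Y`. -/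
noncomputable def legendre (z : Jet1 n m π) : Legendre n m π :=
  ⟨z.pt, fderiv ℝ (fun u : VertHom n m π z.pt => L.toDens z.pt (z.jet.translate u)) 0⟩

/-- In fibred coordinates, `p^λ_i ∘ L̂ = ∂^λ_i 𝓛`. -/
theorem momenta_legendre (hπ : ContMDiff 𝓘(ℝ, Rn n × Rn m) 𝓘(ℝ, Rn n) ∞ π)
    (c : FibredChart n m π) (z : Jet1 n m π) (hz : z.pt ∈ c.total.source) (l : Fin n) (i : Fin m) :
    c.momenta (L.legendre z).mom l i = dVel (L.loc c) l i (c.jetCoord z) := by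
  have hx := c.proj_mem _ hz
  set f : (Fin m → Fin n → ℝ) → ℝ := fun v => L.loc c (c.total z.pt, c.vel z.jet + v)
  have hmem : c.jetCoord z ∈ c.jetDom := ⟨c.total.map_source hz, mem_univ _⟩
  have hd : HasFDerivAt (L.loc c) (fderiv ℝ (L.loc c) (c.jetCoord z)) (c.jetCoord z) :=
    (((L.loc_contDiffOn c).contDiffAt ((c.total.open_target.prod isOpen_univ).mem_nhds
      hmem)).differentiableAt (by simp)).hasFDerivAt
  have hf : HasFDerivAt f ((fderiv ℝ (L.loc c) (c.jetCoord z)).comp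
      (ContinuousLinearMap.inr ℝ (Rn n × Rn m) (Fin m → Fin n → ℝ))) 0 := by
    have h0 : HasFDerivAt (fun v : Fin m → Fin n → ℝ => (c.total z.pt, c.vel z.jet + v))
        (ContinuousLinearMap.inr ℝ (Rn n × Rn m) (Fin m → Fin n → ℝ)) 0 := by
      have h1 : HasFDerivAt (fun v : Fin m → Fin n → ℝ => c.vel z.jet + v)
        (ContinuousLinearMap.id ℝ _) 0 := (hasFDerivAt_id _).const_add _
      exact (hasFDerivAt_const _ _).prodMk h1
    refine HasFDerivAt.comp (g := L.loc c) (0 : Fin m → Fin n → ℝ) ?_ h0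
    rw [add_zero]
    exact hd
  set A := c.vertCoord z.pt
  set D := c.dens (π z.pt)
  have hL : (fun u : VertHom n m π z.pt => L.toDens z.pt (z.jet.translate u)) =
      fun u => f (A u) • D := by
    funext u
    rw [c.dens_eq hx (L.toDens z.pt (z.jet.translate u)),
      L.loc_jetCoord c ⟨z.pt, z.jet.translate u⟩ hz]
    simp only [FibredChart.jetCoord, c.vel_translate, f, A, D]
  set f' := (fderiv ℝ (L.loc c) (c.jetCoord z)).comp
      (ContinuousLinearMap.inr ℝ (Rn n × Rn m) (Fin m → Fin n → ℝ))
  have hD : HasFDerivAt (fun u : VertHom n m π z.pt => L.toDens z.pt (z.jet.translate u))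
      ((f'.comp A).smulRight D) 0 := by
    rw [hL]
    apply HasFDerivAt.of_isLittleOTVS
    have h1 := (hasFDerivAt_iff_isLittleOTVS.1 hf)
    have hA : Filter.Tendsto A (𝓝 0) (𝓝 0) := by
      have := A.continuous.tendsto 0
      rwa [map_zero] at this
    have h2 := (h1.comp_tendsto hA).trans_isBigOTVS
      (A.isBigOTVS_comp (l := 𝓝 0) (f := fun u => u - 0) |>.congr_left (by intro u; simp))
    have h3 := ((ContinuousLinearMap.id ℝ ℝ).smulRight D).isBigOTVS_comp (l := 𝓝 0)
      (f := fun u : VertHom n m π z.pt => f (A u) - f 0 - f' (A u - 0))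
    refine (h3.trans_isLittleOTVS h2).congr_left ?_
    intro u
    simp [sub_smul]
  rw [FibredChart.momenta, legendre]
  change (fderiv ℝ (fun u : VertHom n m π z.pt => L.toDens z.pt (z.jet.translate u)) 0)
    (c.vertBasis z.pt l i) (c.baseFrame (π z.pt)) = _
  rw [hD.fderiv]
  simp [A, D, c.dens_baseFrame hx, c.vertCoord_vertBasis hπ hz, f', dVel]
  rfl

end Lagrangian

/-! ## Hamiltonian forms -/

/-- A Hamiltonian form `H` on `Π`, the pullback of the canonical form of `T*Y ∧ ⋀ⁿ⁻¹T*X` by a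
smooth section over `Π`: to each `q ∈ Π` over `y ∈ Y` it assigns an `n`-form on `T_y Y` (whose
pullback along `T_q Π → T_y Y` is the value at `q` of the form on `Π`), and
`H = p^λ_i dy^i ∧ ω_λ - 𝓗 ω` with smooth `𝓗` in all fibred coordinates. -/
structure HamiltonianForm (n m : ℕ) {X Y : Type*} [TopologicalSpace X] [ChartedSpace (Rn n) X]
    [TopologicalSpace Y] [ChartedSpace (Rn n × Rn m) Y] (π : Y → X) where
  toForm : ∀ q : Legendre n m π, TY n m q.pt [⋀^Fin n]→L[ℝ] ℝ
  smooth : ∀ c : FibredChart n m π, ∃ h : LegCoord n m → ℝ, ContDiffOn ℝ ∞ h c.legDom ∧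
    ∀ q : Legendre n m π, q.pt ∈ c.total.source → ∀ w : Fin n → TY n m q.pt,
      toForm q w = c.taut q.mom w - h (c.legCoord q) * c.vol w

namespace HamiltonianForm

variable (H : HamiltonianForm n m π)

/-- The coordinate expression `𝓗` of a Hamiltonian form. On `c.legDom` it is uniquely
determined. -/
noncomputable def ham (c : FibredChart n m π) : LegCoord n m → ℝ := (H.smooth c).choose

theorem ham_contDiffOn (c : FibredChart n m π) : ContDiffOn ℝ ∞ (H.ham c) c.legDom :=
  (H.smooth c).choose_spec.1

theorem toForm_eq (c : FibredChart n m π) (q : Legendre n m π) (hq : q.pt ∈ c.total.source)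
    (w : Fin n → TY n m q.pt) :
    H.toForm q w = c.taut q.mom w - H.ham c (c.legCoord q) * c.vol w :=
  (H.smooth c).choose_spec.2 q hq w

/-- The pullback of the form `H` at `q` by a jet. -/
noncomputable def pull {y : Y} (σ : JetFibre n m π y) (q : LegFibre n m π y) : Dens n (π y) :=
  (H.toForm ⟨y, q⟩).compContinuousLinearMap σ.lin

theorem pull_apply (hπ : ContMDiff 𝓘(ℝ, Rn n × Rn m) 𝓘(ℝ, Rn n) ∞ π) (c : FibredChart n m π)
    {y : Y} (hy : y ∈ c.total.source) (σ : JetFibre n m π y) (q : LegFibre n m π y) :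
    H.pull σ q (c.baseFrame (π y)) = (∑ l, ∑ i, c.momenta q l i * c.vel σ i l) -
      H.ham c (c.total y, c.momenta q) := by
  have h := H.toForm_eq c ⟨y, q⟩ hy (fun k => σ.lin (c.baseFrame (π y) k))
  rw [c.taut_jet hπ hy, c.vol_jet hπ hy, mul_one] at h
  exact h

theorem pull_hasDerivAt (hπ : ContMDiff 𝓘(ℝ, Rn n × Rn m) 𝓘(ℝ, Rn n) ∞ π)
    (c : FibredChart n m π) {y : Y} (hy : y ∈ c.total.source) (σ : JetFibre n m π y)
    (q d : LegFibre n m π y) :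
    HasDerivAt (fun t : ℝ => H.pull σ (q + t • d) (c.baseFrame (π y)))
      (∑ l, ∑ i, c.momenta d l i *
        (c.vel σ i l - dMom (H.ham c) i l (c.total y, c.momenta q))) 0 := by
  have hmem : (c.total y, c.momenta q) ∈ c.legDom := ⟨c.total.map_source hy, mem_univ _⟩
  have hd : HasFDerivAt (H.ham c) (fderiv ℝ (H.ham c) (c.total y, c.momenta q))
      (c.total y, c.momenta q) :=
    (((H.ham_contDiffOn c).contDiffAt ((c.total.open_target.prod isOpen_univ).mem_nhds
      hmem)).differentiableAt (by simp)).hasFDerivAt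
  have hm : ∀ t : ℝ, c.momenta (q + t • d) = c.momenta q + t • c.momenta d := by
    intro t
    funext l i
    simp [FibredChart.momenta]
  simp only [H.pull_apply hπ c hy, hm]
  have h1 : HasDerivAt (fun t : ℝ => (c.total y, c.momenta q + t • c.momenta d))
      ((0, c.momenta d) : LegCoord n m) 0 := by
    refine (hasDerivAt_const _ _).prodMk ?_
    simpa using ((hasDerivAt_id (0 : ℝ)).smul_const (c.momenta d)).const_add (c.momenta q)
  have h2 : HasDerivAt (fun t : ℝ => H.ham c (c.total y, c.momenta q + t • c.momenta d))
      (fderiv ℝ (H.ham c) (c.total y, c.momenta q) (0, c.momenta d)) 0 := by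
    refine HasFDerivAt.comp_hasDerivAt (0 : ℝ) ?_ h1
    rw [zero_smul, add_zero]
    exact hd
  have h3 : fderiv ℝ (H.ham c) (c.total y, c.momenta q) (0, c.momenta d) =
      ∑ l, ∑ i, c.momenta d l i * dMom (H.ham c) i l (c.total y, c.momenta q) := by
    have : ((0, c.momenta d) : LegCoord n m) =
        ∑ l, ∑ i, c.momenta d l i • ((0, 0), Pi.single l (Pi.single i 1)) := by
      refine Prod.ext ?_ ?_
      · simp [Prod.fst_sum]
        rfl
      · funext l i
        simp [Prod.snd_sum, Finset.sum_apply, Pi.single_apply, ite_apply]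
    rw [this]
    simp only [map_sum, map_smul, dMom, smul_eq_mul]
  have h4 : HasDerivAt (fun t : ℝ => ∑ l, ∑ i, (c.momenta q + t • c.momenta d) l i * c.vel σ i l)
      (∑ l, ∑ i, c.momenta d l i * c.vel σ i l) 0 := by
    refine HasDerivAt.fun_sum fun l _ => HasDerivAt.fun_sum fun i _ => HasDerivAt.mul_const ?_ _
    simpa using ((hasDerivAt_id (0 : ℝ)).mul_const (c.momenta d l i)).const_add (c.momenta q l i)
  refine (h4.sub h2).congr_deriv ?_
  rw [h3]
  simp only [mul_sub, Finset.sum_sub_distrib]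

theorem vel_eq_iff (hπ : ContMDiff 𝓘(ℝ, Rn n × Rn m) 𝓘(ℝ, Rn n) ∞ π) (c : FibredChart n m π)
    {y : Y} (hy : y ∈ c.total.source) (σ : JetFibre n m π y) (q : LegFibre n m π y) :
    (c.vel σ = fun i l => dMom (H.ham c) i l (c.total y, c.momenta q)) ↔
      ∀ (d : LegFibre n m π y) (w : Fin n → TB n (π y)),
        HasDerivAt (fun t : ℝ => H.pull σ (q + t • d) w) 0 0 := by
  constructor
  · intro h d w
    have h1 := (H.pull_hasDerivAt hπ c hy σ q d).mul_const (c.dens (π y) w)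
    simp only [h, sub_self, mul_zero, Finset.sum_const_zero, zero_mul] at h1
    refine h1.congr_of_eventuallyEq (Filter.Eventually.of_forall fun t => ?_)
    have h2 := DFunLike.congr_fun (c.dens_eq (c.proj_mem y hy) (H.pull σ (q + t • d))) w
    exact h2
  · intro h
    funext i l
    obtain ⟨d, hd⟩ := c.exists_momenta hπ hy (Pi.single l (Pi.single i 1))
    have h1 := (H.pull_hasDerivAt hπ c hy σ q d).unique (h d (c.baseFrame (π y)))
    rw [hd] at h1
    simp [Pi.single_apply, ite_apply] at h1
    linarith

end HamiltonianForm

section HamMap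

variable [IsManifold 𝓘(ℝ, Rn n) ∞ X] [IsManifold 𝓘(ℝ, Rn n × Rn m) ∞ Y] {T : Type*}
  [TopologicalSpace T] [ChartedSpace (Rn m) T] [IsManifold 𝓘(ℝ, Rn m) ∞ T]

/-- The value at `q` of the Hamiltonian map `Ĥ : Π → J¹Y`, given by `y^i_λ ∘ Ĥ = ∂^i_λ 𝓗`. It is
written in some fibred coordinates; `vel_hamJet` shows that all of them give the same map. -/
noncomputable def HamiltonianForm.hamJet (H : HamiltonianForm n m π)
    (hπ : IsSmoothFibreBundle (Rn n) (Rn m) T π) (q : Legendre n m π) : JetFibre n m π q.pt :=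
  (hπ.exists_fibredChart q.pt).choose.jetOf hπ.smooth (hπ.exists_fibredChart q.pt).choose_spec
    fun i l => dMom (H.ham (hπ.exists_fibredChart q.pt).choose) i l
      ((hπ.exists_fibredChart q.pt).choose.legCoord q)

/-- In all fibred coordinates, `y^i_λ ∘ Ĥ = ∂^i_λ 𝓗`. -/
theorem HamiltonianForm.vel_hamJet (H : HamiltonianForm n m π)
    (hπ : IsSmoothFibreBundle (Rn n) (Rn m) T π) (c : FibredChart n m π) (q : Legendre n m π)
    (hq : q.pt ∈ c.total.source) :
    c.vel (H.hamJet hπ q) = fun i l => dMom (H.ham c) i l (c.legCoord q) := by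
  refine (H.vel_eq_iff hπ.smooth c hq _ q.mom).2 ?_
  refine (H.vel_eq_iff hπ.smooth (hπ.exists_fibredChart q.pt).choose
    (hπ.exists_fibredChart q.pt).choose_spec _ q.mom).1 ?_
  exact FibredChart.vel_jetOf _ hπ.smooth _ _

/-- The Hamiltonian map `Ĥ : Π → J¹Y`. -/
noncomputable def HamiltonianForm.hamMap (H : HamiltonianForm n m π)
    (hπ : IsSmoothFibreBundle (Rn n) (Rn m) T π) (q : Legendre n m π) : Jet1 n m π :=
  ⟨q.pt, H.hamJet hπ q⟩

/-- `H` is weakly associated with `L`: the equality `H = H_Ĥ + Ĥ*L` of `n`-forms holds at all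
points of `N_L = L̂(J¹Y)`, where `H_Ĥ = p^λ_i dy^i ∧ ω_λ - p^λ_i Ĥ^i_λ ω`. -/
def WeaklyAssociated (L : Lagrangian n m π) (H : HamiltonianForm n m π)
    (hπ : IsSmoothFibreBundle (Rn n) (Rn m) T π) : Prop :=
  ∀ q ∈ range L.legendre, ∀ c : FibredChart n m π, q.pt ∈ c.total.source →
    ∀ w : Fin n → TY n m q.pt,
      H.toForm q w = c.formOfJet q.mom (H.hamJet hπ q) w +
        L.toDens q.pt (H.hamJet hπ q) (fun k => dproj n m π q.pt (w k))

end HamMap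

/-! ## Almost regular Lagrangians -/

/-- The Lagrangian constraint space `N_L = L̂(J¹Y)`, with the subspace topology of `Π`. -/
abbrev Lagrangian.Constraint (L : Lagrangian n m π) : Type _ := ↥(range L.legendre)

/-- The inclusion of `N_L`, with a given smooth structure, into `Π` is a smooth immersion. -/
def Lagrangian.ImmersedConstraint (L : Lagrangian n m π) (k : ℕ)
    [ChartedSpace ((Rn n × Rn m) × Rn k) L.Constraint] : Prop :=
  ∀ c : FibredChart n m π,
    ContMDiffOn 𝓘(ℝ, (Rn n × Rn m) × Rn k) 𝓘(ℝ, LegCoord n m) ∞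
      (fun q : L.Constraint => c.legCoord q.1) {q | q.1.pt ∈ c.total.source} ∧
    ∀ q : L.Constraint, q.1.pt ∈ c.total.source →
      Function.Injective (mfderiv 𝓘(ℝ, (Rn n × Rn m) × Rn k) 𝓘(ℝ, LegCoord n m)
        (fun q : L.Constraint => c.legCoord q.1) q)

/-- The Legendre map, as a map from `J¹Y` onto `N_L` with a given smooth structure, is a smooth
submersion; `g` is its expression in the coordinates of `J¹Y`. -/
def Lagrangian.SubmersiveLegendre (L : Lagrangian n m π) (k : ℕ)
    [ChartedSpace ((Rn n × Rn m) × Rn k) L.Constraint] : Prop :=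
  ∀ c : FibredChart n m π, ∃ g : JetCoord n m → L.Constraint,
    (∀ z : Jet1 n m π, z.pt ∈ c.total.source → (g (c.jetCoord z)).1 = L.legendre z) ∧
    ContMDiffOn 𝓘(ℝ, JetCoord n m) 𝓘(ℝ, (Rn n × Rn m) × Rn k) ∞ g c.jetDom ∧
    ∀ a ∈ c.jetDom, Function.Surjective
      (mfderiv 𝓘(ℝ, JetCoord n m) 𝓘(ℝ, (Rn n × Rn m) × Rn k) g a)

/-- `L` is almost regular: `N_L` is a closed imbedded subbundle of `Π → Y`, and the Legendre map
`J¹Y → N_L` is a fibred manifold, that is, a surjective submersion, with connected fibres. -/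
structure AlmostRegular (L : Lagrangian n m π) : Prop where
  isClosed : IsClosed (range L.legendre)
  fibred : ∃ (k : ℕ) (F : Type) (_ : TopologicalSpace F) (_ : ChartedSpace (Rn k) F)
    (_ : ChartedSpace ((Rn n × Rn m) × Rn k) L.Constraint),
    IsManifold 𝓘(ℝ, Rn k) ∞ F ∧
    IsManifold 𝓘(ℝ, (Rn n × Rn m) × Rn k) ∞ L.Constraint ∧
    IsSmoothFibreBundle (Rn n × Rn m) (Rn k) F (fun q : L.Constraint => q.1.pt) ∧
    L.ImmersedConstraint k ∧ L.SubmersiveLegendre k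
  connected_fibres : ∀ z : Jet1 n m π,
    IsConnected {σ : JetFibre n m π z.pt | L.legendre ⟨z.pt, σ⟩ = L.legendre z}

/-! ## Sections and field equations -/

/-- `s` is a smooth section of `J¹Y → X`. -/
structure IsJetSection (s : X → Jet1 n m π) : Prop where
  proj_pt : ∀ x, π (s x).pt = x
  smooth_pt : ContMDiff 𝓘(ℝ, Rn n) 𝓘(ℝ, Rn n × Rn m) ∞ (fun x => (s x).pt)
  smooth_coord : ∀ c : FibredChart n m π, ContMDiffOn 𝓘(ℝ, Rn n) 𝓘(ℝ, JetCoord n m) ∞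
    (fun x => c.jetCoord (s x)) {x | (s x).pt ∈ c.total.source}

/-- `r` is a smooth section of `Π → X`. -/
structure IsLegSection (r : X → Legendre n m π) : Prop where
  proj_pt : ∀ x, π (r x).pt = x
  smooth_pt : ContMDiff 𝓘(ℝ, Rn n) 𝓘(ℝ, Rn n × Rn m) ∞ (fun x => (r x).pt)
  smooth_coord : ∀ c : FibredChart n m π, ContMDiffOn 𝓘(ℝ, Rn n) 𝓘(ℝ, LegCoord n m) ∞
    (fun x => c.legCoord (r x)) {x | (r x).pt ∈ c.total.source}

/-- The identification of the tangent spaces at equal points. -/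
noncomputable def tangentCast {a b : X} (h : a = b) : TB n a →L[ℝ] TB n b :=
  h ▸ ContinuousLinearMap.id ℝ (TB n a)

/-- The jet prolongation `J¹s : X → J¹Y` of a smooth section `s` of `Y → X`. -/
noncomputable def prolong (hπ : ContMDiff 𝓘(ℝ, Rn n × Rn m) 𝓘(ℝ, Rn n) ∞ π) (s : X → Y)
    (hs : ContMDiff 𝓘(ℝ, Rn n) 𝓘(ℝ, Rn n × Rn m) ∞ s) (h : ∀ x, π (s x) = x) (x : X) :
    Jet1 n m π :=
  ⟨s x, (mfderiv 𝓘(ℝ, Rn n) 𝓘(ℝ, Rn n × Rn m) s x).comp (tangentCast (h x)), fun v => by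
    have h1 : HasMFDerivAt 𝓘(ℝ, Rn n) 𝓘(ℝ, Rn n) (π ∘ s) x
        ((dproj n m π (s x)).comp (mfderiv 𝓘(ℝ, Rn n) 𝓘(ℝ, Rn n × Rn m) s x)) :=
      HasMFDerivAt.comp x (hπ.mdifferentiable (by simp) (s x)).hasMFDerivAt
        (hs.mdifferentiable (by simp) x).hasMFDerivAt
    have h2 : π ∘ s = id := funext h
    rw [h2] at h1
    have h3 := hasMFDerivAt_unique h1 (hasMFDerivAt_id x)
    have h4 : ∀ {a b : X} (e : a = b) (v : TB n a), (tangentCast e v : Rn n) = v := by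
      intro a b e v
      subst e
      rfl
    have h5 := DFunLike.congr_fun h3 (tangentCast (h x) v)
    refine Eq.trans h5 (h4 (h x) v)⟩

/-- `s̄` is a solution of the Cartan equations of `L`. Along `s̄`, the coordinates `ŷ^i_λ` and
`y^i_{λμ}` of the repeated jet manifold are the partial derivatives `∂_λ s̄^i` and `∂_λ s̄^i_μ`. -/
structure IsCartanSolution (L : Lagrangian n m π) (s : X → Jet1 n m π) : Prop where
  isSection : IsJetSection s
  vel_eq : ∀ (c : FibredChart n m π) (x : X), (s x).pt ∈ c.total.source →
    let P := fun l i => dVel (L.loc c) l i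
    let a := c.jetCoord (s x)
    let D := fun l => fderiv ℝ (fun ξ => c.jetCoord (s (c.base.symm ξ))) (c.base x) (bvec l)
    let yhat := fun j μ => (D μ).1.2 j
    ∀ l i, ∑ j, ∑ μ, dVel (P μ j) l i a * (yhat j μ - a.2 j μ) = 0
  field_eq : ∀ (c : FibredChart n m π) (x : X), (s x).pt ∈ c.total.source →
    let P := fun l i => dVel (L.loc c) l i
    let a := c.jetCoord (s x)
    let D := fun l => fderiv ℝ (fun ξ => c.jetCoord (s (c.base.symm ξ))) (c.base x) (bvec l)
    let yhat := fun j μ => (D μ).1.2 j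
    let y2 := fun l j μ => (D l).2 j μ
    let dhat := fun l (f : JetCoord n m → ℝ) =>
      dBase f l a + ∑ j, yhat j l * dFib f j a + ∑ j, ∑ μ, y2 l j μ * dVel f μ j a
    ∀ i, dFib (L.loc c) i a - ∑ l, dhat l (P l i)
      + ∑ l, ∑ j, (yhat j l - a.2 j l) * dFib (P l j) i a = 0

/-- `r` is a solution of the covariant Hamilton equations `∂_λ r^i = ∂^i_λ 𝓗`,
`∂_λ r^λ_i = - ∂_i 𝓗` of `H`. -/
structure IsHamiltonSolution (H : HamiltonianForm n m π) (r : X → Legendre n m π) : Prop where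
  isSection : IsLegSection r
  vel_eq : ∀ (c : FibredChart n m π) (x : X), (r x).pt ∈ c.total.source →
    let a := c.legCoord (r x)
    let D := fun l => fderiv ℝ (fun ξ => c.legCoord (r (c.base.symm ξ))) (c.base x) (bvec l)
    ∀ l i, (D l).1.2 i = dMom (H.ham c) i l a
  mom_eq : ∀ (c : FibredChart n m π) (x : X), (r x).pt ∈ c.total.source →
    let a := c.legCoord (r x)
    let D := fun l => fderiv ℝ (fun ξ => c.legCoord (r (c.base.symm ξ))) (c.base x) (bvec l)
    ∀ i, ∑ l, (D l).2 l i = - dFib (H.ham c) i a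

end Mechanics

/-!
The proof rests on one fact about the Lagrangian: in each chart, the Hessian
`∂²𝓛/∂y^i_λ∂y^j_μ` has a kernel of constant dimension. Indeed the Legendre map is a submersion onto
`N_L` followed by an immersion, and its tangent map is the identity on `(x, y)` and the Hessian on
the velocities (`AlmostRegular.exists_finrank_ker_hessian`).

For a function `f` on `B × E` whose Hessian along `E` has a kernel of constant dimension, all first
derivatives of the Hessian vanish on pairs of vectors of the kernel, because a generalized inverse
of the Hessian can be chosen smoothly (`fderiv_hessian_apply_ker`). So, if `w` is in the kernel at
`(b, v)`, it stays in the kernel along the segment from `v` to `v + w`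
(`hessian_apply_segment_eq_zero`); along it the momenta `∂f/∂v` are constant (`fibreDeriv_add_ker`)
and the derivatives of `f` with respect to `b` are affine (`fderiv_base_add_ker`).

The first Cartan equation says that `w = ŷ - y` is in the kernel of the Hessian at `s̄(x)`. Hence
`ŷ` has the momenta of `s̄(x)`, and the second Cartan equation becomes `∂_λ r^λ_i = ∂_i 𝓛` at
`(x, s^i, ŷ)`. The assumption on `Ĥ ∘ L̂ ∘ s̄` says that `ŷ = ∂𝓗/∂p` along `r`, which is the first
Hamilton equation. Finally, differentiating `𝓗 = p · ∂𝓗/∂p - 𝓛(x, y, ∂𝓗/∂p)`, which is the weak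
association pulled back to `J¹Y` by the Legendre map, with respect to `y^i` gives `∂_i 𝓗 = -∂_i 𝓛`
at `ŷ` (`fderiv_base_hamiltonian`): the terms with derivatives of `∂𝓗/∂p` cancel, since `ŷ` has the
momenta of `s̄(x)`. It is only along `r` that `L̂ ∘ Ĥ` is the identity; weak association does not
imply it on all of `N_L`.
-/

/-! ### Generalized inverses and families of symmetric forms -/

section GeneralizedInverse

variable {E F : Type*} [NormedAddCommGroup E] [NormedSpace ℝ E] [FiniteDimensional ℝ E]
  [NormedAddCommGroup F] [NormedSpace ℝ F] [FiniteDimensional ℝ F]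

/-- Every linear map `A` has a reflexive generalized inverse: `ASA = A` and `SAS = S`. -/
theorem ContinuousLinearMap.exists_generalizedInverse (A : E →L[ℝ] F) :
    ∃ S : F →L[ℝ] E, (∀ w, A (S (A w)) = A w) ∧ ∀ f, S (A (S f)) = S f := by
  obtain ⟨g, hg⟩ := (A : E →ₗ[ℝ] F).rangeRestrict.exists_rightInverse_of_surjective
    (LinearMap.range_rangeRestrict _)
  obtain ⟨S, hS⟩ := LinearMap.exists_extend g
  have h : ∀ w, A (S (A w)) = A w := by
    intro w
    have h1 := DFunLike.congr_fun hS ((A : E →ₗ[ℝ] F).rangeRestrict w)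
    have h2 := DFunLike.congr_fun hg ((A : E →ₗ[ℝ] F).rangeRestrict w)
    exact (congrArg A h1).trans (congrArg Subtype.val h2)
  refine ⟨LinearMap.toContinuousLinearMap (S ∘ₗ (A : E →ₗ[ℝ] F) ∘ₗ S), ?_, ?_⟩
  · intro w
    change A (S (A (S (A w)))) = A w
    rw [h, h]
  · intro f
    change S (A (S (A (S (A (S f)))))) = S (A (S f))
    rw [h, h]

/-- Among the linear maps whose kernel has the same dimension as that of `A₀`, a generalized
inverse can be chosen that is smooth at `A₀`. With a generalized inverse `S` of `A₀`, the choice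
is `A ↦ (1 + S (A - A₀))⁻¹ S`. -/
theorem ContinuousLinearMap.exists_smooth_generalizedInverse (A₀ : E →L[ℝ] F) :
    ∃ G : (E →L[ℝ] F) → (F →L[ℝ] E), DifferentiableAt ℝ G A₀ ∧ ∀ᶠ A in 𝓝 A₀,
      Module.finrank ℝ A.ker = Module.finrank ℝ A₀.ker → ∀ w, A (G A (A w)) = A w := by
  obtain ⟨S, hS1, hS2⟩ := A₀.exists_generalizedInverse
  set M : (E →L[ℝ] F) → (E →L[ℝ] E) := fun A => 1 + S.comp (A - A₀) with hM
  have hMd : Differentiable ℝ M := by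
    intro A
    have h1 : DifferentiableAt ℝ (fun A : E →L[ℝ] F => S.comp (A - A₀)) A :=
      (((ContinuousLinearMap.compL ℝ E F E) S).differentiableAt).comp A
        (differentiableAt_id.sub_const A₀)
    exact h1.const_add 1
  have hM0 : M A₀ = 1 := by simp [hM]
  refine ⟨fun A => (Ring.inverse (M A)).comp S, ?_, ?_⟩
  · have h1 : DifferentiableAt ℝ (fun A => Ring.inverse (M A)) A₀ := by
      have h2 : DifferentiableAt ℝ (Ring.inverse : (E →L[ℝ] E) → _) (M A₀) := by
        rw [hM0]
        exact differentiableAt_inverse (𝕜 := ℝ) isUnit_one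
      exact h2.comp A₀ (hMd A₀)
    exact (((ContinuousLinearMap.compL ℝ F E E).flip S).differentiableAt).comp A₀ h1
  have hu : ∀ᶠ A in 𝓝 A₀, IsUnit (M A) := by
    refine hMd.continuous.continuousAt.eventually (p := fun B => IsUnit B) ?_
    rw [hM0]
    exact Units.isOpen.mem_nhds isUnit_one
  filter_upwards [hu] with A hA hrank w
  have e1 : ∀ v, Ring.inverse (M A) (M A v) = v := fun v =>
    DFunLike.congr_fun (Ring.inverse_mul_cancel _ hA) v
  have e2 : ∀ v, M A (Ring.inverse (M A) v) = v := fun v =>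
    DFunLike.congr_fun (Ring.mul_inverse_cancel _ hA) v
  have hMv : ∀ v, M A v = v + S (A v) - S (A₀ v) := by
    intro v
    simp [hM]
    abel
  have hle : A.ker ≤ (S.comp A).ker := by
    intro v hv
    have : A v = 0 := hv
    change S (A v) = 0
    rw [this, map_zero]
  -- `1 - S A₀` maps `ker (S A)` injectively to `ker A₀`, as it agrees there with `M A`.
  have hfin : Module.finrank ℝ (S.comp A).ker ≤ Module.finrank ℝ A₀.ker := by
    have hmaps : ∀ v ∈ (S.comp A).ker, (M A : E →ₗ[ℝ] E) v ∈ A₀.ker := by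
      intro v hv
      have hv' : S (A v) = 0 := hv
      change A₀ (M A v) = 0
      rw [hMv, hv', add_zero, map_sub, hS1, sub_self]
    refine LinearMap.finrank_le_finrank_of_injective
      (f := (M A : E →ₗ[ℝ] E).restrict hmaps) ?_
    intro v v' h
    have h' : M A v = M A v' := congrArg Subtype.val h
    ext1
    rw [← e1 v, h', e1]
  have heq := Submodule.eq_of_le_of_finrank_le hle (hfin.trans hrank.ge)
  set W := w - Ring.inverse (M A) (S (A w)) with hW
  have hMW : M A W = w - S (A₀ w) := by
    rw [hW, map_sub, e2, hMv]
    abel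
  have hPW : W - S (A₀ W) = w - S (A₀ w) := by
    have h1 : M A W - S (A₀ (M A W)) = W - S (A₀ W) := by
      rw [hMv]
      simp only [map_add, map_sub, hS2]
      abel
    rw [← h1, hMW]
    simp only [map_sub, hS2]
    abel
  have hSW : S (A W) = 0 := by
    rw [hMv, ← hPW] at hMW
    have : W + S (A W) - S (A₀ W) = S (A W) + (W - S (A₀ W)) := by abel
    rw [this] at hMW
    simpa using hMW
  have hAW : W ∈ A.ker := by
    rw [heq]
    exact hSW
  have hAW' : A W = 0 := hAW
  rw [hW, map_sub, sub_eq_zero] at hAW'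
  exact hAW'.symm

/-- If symmetric bilinear forms `A t` have kernels of constant dimension, the derivative `A'`
vanishes on pairs of vectors of the kernel: with smooth generalized inverses `G t`,
`A t w w' = A t w' (G t (A t w))` is a product of two factors that vanish. -/
theorem hasDerivAt_apply_ker_eq_zero {A : ℝ → E →L[ℝ] E →L[ℝ] ℝ} {A' : E →L[ℝ] E →L[ℝ] ℝ} {t₀ : ℝ}
    (hA : HasDerivAt A A' t₀)
    (hrank : ∀ᶠ t in 𝓝 t₀, Module.finrank ℝ (A t).ker = Module.finrank ℝ (A t₀).ker)
    (hsymm : ∀ᶠ t in 𝓝 t₀, ∀ w w', A t w w' = A t w' w) {w w' : E} (hw : A t₀ w = 0)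
    (hw' : A t₀ w' = 0) : A' w w' = 0 := by
  obtain ⟨G, hG, hGA⟩ := (A t₀).exists_smooth_generalizedInverse
  have h1 : HasDerivAt (fun t => A t w w') (A' w w') t₀ := by
    simpa using (hA.clm_apply (hasDerivAt_const t₀ w)).clm_apply (hasDerivAt_const t₀ w')
  have h2 : HasDerivAt (fun t => A t w' (G (A t) (A t w))) 0 t₀ := by
    have hGt : HasDerivAt (fun t => G (A t)) (fderiv ℝ G (A t₀) A') t₀ :=
      hG.hasFDerivAt.comp_hasDerivAt t₀ hA
    have hAw : HasDerivAt (fun t => A t w) (A' w) t₀ := by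
      simpa using hA.clm_apply (hasDerivAt_const t₀ w)
    have hAw' : HasDerivAt (fun t => A t w') (A' w') t₀ := by
      simpa using hA.clm_apply (hasDerivAt_const t₀ w')
    simpa [hw, hw'] using hAw'.clm_apply (hGt.clm_apply hAw)
  refine h1.unique (h2.congr_of_eventuallyEq ?_)
  filter_upwards [hrank, hsymm, hA.continuousAt.eventually hGA] with t ht hs hg
  rw [hs w', hg ht]

end GeneralizedInverse

/-! ### Functions whose fibrewise Hessian has constant rank -/

section Hessian

variable {B E : Type*} [NormedAddCommGroup B] [NormedSpace ℝ B]
  [NormedAddCommGroup E] [NormedSpace ℝ E]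

/-- The derivative of a function on `B × E` along the fibre `E`. -/
noncomputable def fibreDeriv {F : Type*} [NormedAddCommGroup F] [NormedSpace ℝ F] (f : B × E → F)
    (a : B × E) : E →L[ℝ] F :=
  (fderiv ℝ f a).comp (ContinuousLinearMap.inr ℝ B E)

theorem fibreDeriv_apply {F : Type*} [NormedAddCommGroup F] [NormedSpace ℝ F] (f : B × E → F)
    (a : B × E) (w : E) : fibreDeriv f a w = fderiv ℝ f a (0, w) := rfl

theorem ContDiffAt.fibreDeriv {F : Type*} [NormedAddCommGroup F] [NormedSpace ℝ F] {f : B × E → F}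
    {a : B × E} (hf : ContDiffAt ℝ ∞ f a) : ContDiffAt ℝ ∞ (_root_.fibreDeriv f) a :=
  (hf.fderiv_right (by simp)).clm_comp contDiffAt_const

theorem ContDiffAt.hasFDerivAt_of_infty {F G : Type*} [NormedAddCommGroup F] [NormedSpace ℝ F]
    [NormedAddCommGroup G] [NormedSpace ℝ G] {f : F → G} {a : F} (hf : ContDiffAt ℝ ∞ f a) :
    HasFDerivAt f (fderiv ℝ f a) a :=
  (hf.differentiableAt (by simp)).hasFDerivAt

theorem ContDiffAt.hasDerivAt_line {F G : Type*} [NormedAddCommGroup F] [NormedSpace ℝ F]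
    [NormedAddCommGroup G] [NormedSpace ℝ G] {f : F → G} {a ξ : F} {t : ℝ}
    (hf : ContDiffAt ℝ ∞ f (a + t • ξ)) :
    HasDerivAt (fun t : ℝ => f (a + t • ξ)) (fderiv ℝ f (a + t • ξ) ξ) t := by
  have hc : HasDerivAt (fun t : ℝ => a + t • ξ) ξ t := by
    simpa using ((hasDerivAt_id t).smul_const ξ).const_add a
  exact HasFDerivAt.comp_hasDerivAt (l := f) t hf.hasFDerivAt_of_infty hc

theorem ContDiffAt.hasDerivAt_fibre_line {F : Type*} [NormedAddCommGroup F] [NormedSpace ℝ F]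
    {f : B × E → F} {b : B} {v w : E} {t : ℝ} (hf : ContDiffAt ℝ ∞ f (b, v + t • w)) :
    HasDerivAt (fun t : ℝ => f (b, v + t • w)) (_root_.fibreDeriv f (b, v + t • w) w) t := by
  have hc : HasDerivAt (fun t : ℝ => (b, v + t • w)) ((0, w) : B × E) t := by
    refine (hasDerivAt_const t b).prodMk ?_
    simpa using ((hasDerivAt_id t).smul_const w).const_add v
  exact HasFDerivAt.comp_hasDerivAt (l := f) t hf.hasFDerivAt_of_infty hc

/-- Derivatives along the fibre commute with all other derivatives. -/
theorem fderiv_fibreDeriv_apply {F : Type*} [NormedAddCommGroup F] [NormedSpace ℝ F]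
    {f : B × E → F} {a : B × E} (hf : ContDiffAt ℝ ∞ f a) (ξ : B × E) (w : E) :
    fderiv ℝ (fibreDeriv f) a ξ w = fderiv ℝ (fun a => fderiv ℝ f a ξ) a (0, w) := by
  have h1 : HasFDerivAt (fderiv ℝ f) (fderiv ℝ (fderiv ℝ f) a) a :=
    (hf.fderiv_right (m := ∞) (by simp)).hasFDerivAt_of_infty
  have h2 : HasFDerivAt (fibreDeriv f)
      (((ContinuousLinearMap.compL ℝ E (B × E) F).flip (ContinuousLinearMap.inr ℝ B E)).comp
        (fderiv ℝ (fderiv ℝ f) a)) a :=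
    ((ContinuousLinearMap.compL ℝ E (B × E) F).flip
      (ContinuousLinearMap.inr ℝ B E)).hasFDerivAt.comp a h1
  have h3 : HasFDerivAt (fun a => fderiv ℝ f a ξ)
      ((ContinuousLinearMap.apply ℝ F ξ).comp (fderiv ℝ (fderiv ℝ f) a)) a :=
    (ContinuousLinearMap.apply ℝ F ξ).hasFDerivAt.comp a h1
  rw [h2.fderiv, h3.fderiv]
  exact (hf.isSymmSndFDerivAt
    (by simpa using WithTop.coe_le_coe.2 (le_top (a := (2 : ℕ∞))))).eq ξ (0, w)

theorem fibreDeriv_fibreDeriv_symm {F : Type*} [NormedAddCommGroup F] [NormedSpace ℝ F]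
    {f : B × E → F} {a : B × E} (hf : ContDiffAt ℝ ∞ f a) (w w' : E) :
    fibreDeriv (fibreDeriv f) a w w' = fibreDeriv (fibreDeriv f) a w' w := by
  have h1 : HasFDerivAt (fderiv ℝ f) (fderiv ℝ (fderiv ℝ f) a) a :=
    (hf.fderiv_right (m := ∞) (by simp)).hasFDerivAt_of_infty
  have h2 : HasFDerivAt (fibreDeriv f)
      (((ContinuousLinearMap.compL ℝ E (B × E) F).flip (ContinuousLinearMap.inr ℝ B E)).comp
        (fderiv ℝ (fderiv ℝ f) a)) a :=
    ((ContinuousLinearMap.compL ℝ E (B × E) F).flip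
      (ContinuousLinearMap.inr ℝ B E)).hasFDerivAt.comp a h1
  rw [fibreDeriv_apply, fibreDeriv_apply, h2.fderiv]
  exact (hf.isSymmSndFDerivAt
    (by simpa using WithTop.coe_le_coe.2 (le_top (a := (2 : ℕ∞))))).eq (0, w) (0, w')


theorem fderiv_hessian_symm {f : B × E → ℝ} {D : Set (B × E)} (hD : IsOpen D)
    (hf : ∀ a ∈ D, ContDiffAt ℝ ∞ f a) {a : B × E} (ha : a ∈ D) (ξ : B × E) (w w' : E) :
    fderiv ℝ (fibreDeriv (fibreDeriv f)) a ξ w w' =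
      fderiv ℝ (fibreDeriv (fibreDeriv f)) a ξ w' w := by
  have h := (hf a ha).fibreDeriv.fibreDeriv.hasFDerivAt_of_infty
  have h1 : ∀ w w', HasFDerivAt (fun a => fibreDeriv (fibreDeriv f) a w w')
      ((ContinuousLinearMap.apply ℝ ℝ w').comp ((ContinuousLinearMap.apply ℝ (E →L[ℝ] ℝ) w).comp
        (fderiv ℝ (fibreDeriv (fibreDeriv f)) a))) a := fun w w' =>
    HasFDerivAt.comp (f := fibreDeriv (fibreDeriv f)) a ((ContinuousLinearMap.apply ℝ ℝ w').comp
      (ContinuousLinearMap.apply ℝ (E →L[ℝ] ℝ) w)).hasFDerivAt h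
  have h2 := (h1 w w').unique ((h1 w' w).congr_of_eventuallyEq (by
    filter_upwards [hD.mem_nhds ha] with c hc
    exact fibreDeriv_fibreDeriv_symm (hf c hc) w w'))
  exact DFunLike.congr_fun h2 ξ

variable [FiniteDimensional ℝ E]

/-- Where the Hessian along the fibres has kernel of constant dimension, all its derivatives
vanish on pairs of vectors of the kernel. -/
theorem fderiv_hessian_apply_ker {f : B × E → ℝ} {D : Set (B × E)} (hD : IsOpen D)
    (hf : ∀ a ∈ D, ContDiffAt ℝ ∞ f a) {d : ℕ}
    (hd : ∀ a ∈ D, Module.finrank ℝ (fibreDeriv (fibreDeriv f) a).ker = d) {a : B × E} (ha : a ∈ D)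
    (ξ : B × E) {w w' : E} (hw : fibreDeriv (fibreDeriv f) a w = 0)
    (hw' : fibreDeriv (fibreDeriv f) a w' = 0) :
    fderiv ℝ (fibreDeriv (fibreDeriv f)) a ξ w w' = 0 := by
  have h0 : a + (0 : ℝ) • ξ = a := by simp
  have hH : HasDerivAt (fun t : ℝ => fibreDeriv (fibreDeriv f) (a + t • ξ))
      (fderiv ℝ (fibreDeriv (fibreDeriv f)) a ξ) 0 := by
    have h := (hf a ha).fibreDeriv.fibreDeriv
    rw [← h0] at h
    simpa only [h0] using h.hasDerivAt_line
  have hmem : ∀ᶠ t in 𝓝 (0 : ℝ), a + t • ξ ∈ D := by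
    have hc : Continuous fun t : ℝ => a + t • ξ := by fun_prop
    exact (hD.preimage hc).mem_nhds (by simpa using ha)
  refine hasDerivAt_apply_ker_eq_zero hH ?_ ?_ (by rwa [h0]) (by rwa [h0])
  · filter_upwards [hmem] with t ht
    rw [hd _ ht, h0, hd _ ha]
  · filter_upwards [hmem] with t ht w w'
    exact fibreDeriv_fibreDeriv_symm (hf _ ht) w w'

/-- If the Hessian along the fibre has kernel of constant dimension, then a vector `w` of the
kernel at `v` stays in the kernel along the segment from `v` to `v + w`. Up to the Hessian applied
to `w`, the vector `w` lies in the kernel, where the third derivative vanishes; so the Hessian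
applied to `w` satisfies a Grönwall inequality along the segment. -/
theorem hessian_apply_segment_eq_zero {f : B × E → ℝ} {U : Set B} (hU : IsOpen U)
    (hf : ∀ a ∈ U ×ˢ (univ : Set E), ContDiffAt ℝ ∞ f a) {d : ℕ}
    (hd : ∀ a ∈ U ×ˢ (univ : Set E), Module.finrank ℝ (fibreDeriv (fibreDeriv f) a).ker = d)
    {b : B} (hb : b ∈ U) {v w : E} (hw : fibreDeriv (fibreDeriv f) (b, v) w = 0) :
    ∀ t ∈ Icc (0 : ℝ) 1, fibreDeriv (fibreDeriv f) (b, v + t • w) w = 0 := by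
  set H := fibreDeriv (fibreDeriv f) with hHdef
  have hD : IsOpen (U ×ˢ (univ : Set E)) := hU.prod isOpen_univ
  have hmem : ∀ t : ℝ, (b, v + t • w) ∈ U ×ˢ (univ : Set E) := fun t => ⟨hb, mem_univ _⟩
  have hcurve : Continuous fun t : ℝ => (b, v + t • w) := by fun_prop
  have hHs : ∀ t : ℝ, ContDiffAt ℝ ∞ H (b, v + t • w) := fun t =>
    (hf _ (hmem t)).fibreDeriv.fibreDeriv
  have hHt : ∀ t : ℝ, HasDerivAt (fun t : ℝ => H (b, v + t • w))
      (fderiv ℝ H (b, v + t • w) (0, w)) t := fun t =>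
    (hHs t).hasDerivAt_fibre_line
  have hat : ∀ t : ℝ, HasDerivAt (fun t : ℝ => H (b, v + t • w) w)
      (fderiv ℝ H (b, v + t • w) (0, w) w) t := by
    intro t
    simpa using (hHt t).clm_apply (hasDerivAt_const t w)
  have hcont : Continuous fun t : ℝ => H (b, v + t • w) w :=
    continuous_iff_continuousAt.2 fun t => (hat t).continuousAt
  refine IsClosed.Icc_subset_of_forall_exists_gt (s := {t : ℝ | H (b, v + t • w) w = 0}) ?_ ?_ ?_
  · exact (isClosed_singleton.preimage hcont).inter isClosed_Icc
  · simpa using hw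
  rintro t₀ ⟨ht₀, -⟩ t₁ ht₁
  obtain ⟨G, hG, hGH⟩ := (H (b, v + t₀ • w)).exists_smooth_generalizedInverse
  -- Local bounds for the generalized inverse, the third derivative and the Hessian.
  have hGc : ContinuousAt (fun t : ℝ => ‖G (H (b, v + t • w))‖) t₀ :=
    (ContinuousAt.comp (f := fun t : ℝ => H (b, v + t • w)) hG.continuousAt
      (hHt t₀).continuousAt).norm
  have hTc : ContinuousAt (fun t : ℝ => ‖fderiv ℝ H (b, v + t • w)‖) t₀ :=
    (ContinuousAt.comp (f := fun t : ℝ => (b, v + t • w))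
      ((hHs t₀).fderiv_right (m := ∞) (by simp)).continuousAt hcurve.continuousAt).norm
  have hac : ContinuousAt (fun t : ℝ => ‖H (b, v + t • w) w‖) t₀ := (hat t₀).continuousAt.norm
  obtain ⟨C₁, hC₁⟩ : ∃ C, ‖G (H (b, v + t₀ • w))‖ < C := exists_gt _
  obtain ⟨C₂, hC₂⟩ : ∃ C, ‖fderiv ℝ H (b, v + t₀ • w)‖ < C := exists_gt _
  obtain ⟨C₃, hC₃⟩ : ∃ C, ‖H (b, v + t₀ • w) w‖ < C := exists_gt _
  have hC₁0 : 0 ≤ C₁ := (norm_nonneg _).trans hC₁.le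
  have hC₂0 : 0 ≤ C₂ := (norm_nonneg (fderiv ℝ H (b, v + t₀ • w))).trans hC₂.le
  have hC₃0 : 0 ≤ C₃ := (norm_nonneg _).trans hC₃.le
  set K := C₂ * C₁ * (2 * ‖w‖ + C₁ * C₃) with hK
  have hbound : ∀ᶠ t in 𝓝 t₀,
      ‖fderiv ℝ H (b, v + t • w) (0, w) w‖ ≤ K * ‖H (b, v + t • w) w‖ := by
    filter_upwards [(hHt t₀).continuousAt.eventually hGH, hGc.eventually_lt_const hC₁,
      hTc.eventually_lt_const hC₂, hac.eventually_lt_const hC₃] with t h1 h2 h3 h4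
    set a : B × E := (b, v + t • w) with ha
    set T := fderiv ℝ H a with hT
    set e := G (H a) (H a w) with he
    have hk : H a (w - e) = 0 := by
      rw [map_sub, he, h1 ((hd _ (hmem t)).trans (hd _ (hmem t₀)).symm), sub_self]
    have hen : ‖e‖ ≤ C₁ * ‖H a w‖ :=
      (ContinuousLinearMap.le_opNorm _ _).trans (by gcongr)
    have hwe : ‖w - e‖ ≤ ‖w‖ + C₁ * C₃ :=
      (norm_sub_le _ _).trans (by gcongr; exact hen.trans (by gcongr))
    have hTn : ∀ x y z : E, ‖T (0, x) y z‖ ≤ C₂ * ‖x‖ * ‖y‖ * ‖z‖ := by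
      intro x y z
      have g1 : ‖T (0, x)‖ ≤ C₂ * ‖x‖ := by
        refine (T.le_opNorm _).trans ?_
        have : ‖((0, x) : B × E)‖ = ‖x‖ := by simp [Prod.norm_def]
        rw [this]
        gcongr
      refine ((T (0, x) y).le_opNorm _).trans ?_
      gcongr
      refine ((T (0, x)).le_opNorm _).trans ?_
      gcongr
    have hT1 : ∀ x y z : E, T (0, x) y z = T (0, x) z y := fun x y z =>
      fderiv_hessian_symm hD hf (hmem t) (0, x) y z
    have hT2 : ∀ x y : E, T (0, x) y = T (0, y) x := fun x y =>
      fibreDeriv_fibreDeriv_symm (hf _ (hmem t)).fibreDeriv x y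
    refine ContinuousLinearMap.opNorm_le_bound _ (by positivity) fun u => ?_
    have hker : T (0, u) (w - e) (w - e) = 0 :=
      fderiv_hessian_apply_ker hD hf hd (hmem t) (0, u) hk hk
    have hsplit : T (0, w) w u = T (0, u) e w + T (0, u) e (w - e) := by
      have g1 : T (0, w) w u = T (0, u) w w := by
        rw [hT1, hT2 w u]
      rw [hT1 u e (w - e), g1]
      simp only [map_sub, sub_apply] at hker ⊢
      linarith
    rw [hsplit]
    calc ‖T (0, u) e w + T (0, u) e (w - e)‖
        ≤ C₂ * ‖u‖ * ‖e‖ * ‖w‖ + C₂ * ‖u‖ * ‖e‖ * ‖w - e‖ :=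
          (norm_add_le _ _).trans (add_le_add (hTn _ _ _) (hTn _ _ _))
      _ ≤ C₂ * ‖u‖ * (C₁ * ‖H a w‖) * ‖w‖ + C₂ * ‖u‖ * (C₁ * ‖H a w‖) * (‖w‖ + C₁ * C₃) := by
          gcongr
      _ = K * ‖H a w‖ * ‖u‖ := by
          rw [hK]
          ring
  obtain ⟨ε, hε, hball⟩ := Metric.eventually_nhds_iff.1 hbound
  have ht₁' : t₀ < t₁ := ht₁
  set r := min t₁ (t₀ + ε / 2) with hr
  have hr0 : t₀ < r := lt_min ht₁' (by linarith)
  refine ⟨r, ?_, hr0, min_le_left _ _⟩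
  refine eq_zero_of_abs_deriv_le_mul_abs_self_of_eq_zero_right (a := t₀) (b := r) (K := K)
    hcont.continuousOn (fun t _ => (hat t).hasDerivWithinAt) ht₀ ?_ r ⟨hr0.le, le_rfl⟩
  intro t ht
  refine hball ?_
  have h1 : r ≤ t₀ + ε / 2 := min_le_right _ _
  rw [Real.dist_eq, abs_of_nonneg (by linarith [ht.1])]
  linarith [ht.2]

/-- Translation by a vector of the kernel of the Hessian along the fibre does not change the
derivative along the fibre, if the kernel has constant dimension. -/
theorem fibreDeriv_add_ker {f : B × E → ℝ} {U : Set B} (hU : IsOpen U)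
    (hf : ∀ a ∈ U ×ˢ (univ : Set E), ContDiffAt ℝ ∞ f a) {d : ℕ}
    (hd : ∀ a ∈ U ×ˢ (univ : Set E), Module.finrank ℝ (fibreDeriv (fibreDeriv f) a).ker = d)
    {b : B} (hb : b ∈ U) {v w : E} (hw : fibreDeriv (fibreDeriv f) (b, v) w = 0) :
    fibreDeriv f (b, v + w) = fibreDeriv f (b, v) := by
  have hseg := hessian_apply_segment_eq_zero hU hf hd hb hw
  have hP : ∀ t : ℝ, HasDerivAt (fun t : ℝ => fibreDeriv f (b, v + t • w))
      (fibreDeriv (fibreDeriv f) (b, v + t • w) w) t := fun t =>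
    (hf (b, v + t • w) ⟨hb, mem_univ _⟩).fibreDeriv.hasDerivAt_fibre_line
  have h := constant_of_has_deriv_right_zero (a := (0 : ℝ)) (b := 1)
    (fun t _ => (hP t).continuousAt.continuousWithinAt)
    (fun t ht => by
      have := (hP t).hasDerivWithinAt (s := Ici t)
      rwa [hseg t ⟨ht.1, ht.2.le⟩] at this) 1 ⟨zero_le_one, le_rfl⟩
  simpa using h

/-- Along the translate by a vector `w` of the kernel of the Hessian along the fibre, the
derivatives of `f` in the direction of the base are affine, if the kernel has constant
dimension. -/
theorem fderiv_base_add_ker {f : B × E → ℝ} {U : Set B} (hU : IsOpen U)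
    (hf : ∀ a ∈ U ×ˢ (univ : Set E), ContDiffAt ℝ ∞ f a) {d : ℕ}
    (hd : ∀ a ∈ U ×ˢ (univ : Set E), Module.finrank ℝ (fibreDeriv (fibreDeriv f) a).ker = d)
    {b : B} (hb : b ∈ U) {v w : E} (hw : fibreDeriv (fibreDeriv f) (b, v) w = 0) (β : B) :
    fderiv ℝ f (b, v + w) (β, 0) =
      fderiv ℝ f (b, v) (β, 0) + fderiv ℝ (fibreDeriv f) (b, v) (β, 0) w := by
  have hseg := hessian_apply_segment_eq_zero hU hf hd hb hw
  have hD : IsOpen (U ×ˢ (univ : Set E)) := hU.prod isOpen_univ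
  have hmem : ∀ t : ℝ, (b, v + t • w) ∈ U ×ˢ (univ : Set E) := fun t => ⟨hb, mem_univ _⟩
  have hg : ∀ t : ℝ, HasDerivAt (fun t : ℝ => fderiv ℝ f (b, v + t • w) (β, 0))
      (fderiv ℝ (fibreDeriv f) (b, v + t • w) (β, 0) w) t := by
    intro t
    rw [fderiv_fibreDeriv_apply (hf _ (hmem t))]
    have h1 : ContDiffAt ℝ ∞ (fun a => fderiv ℝ f a (β, 0)) (b, v + t • w) :=
      ((hf _ (hmem t)).fderiv_right (by simp)).clm_apply contDiffAt_const
    exact h1.hasDerivAt_fibre_line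
  have hh : ∀ t ∈ Icc (0 : ℝ) 1,
      HasDerivAt (fun t : ℝ => fderiv ℝ (fibreDeriv f) (b, v + t • w) (β, 0) w) 0 t := by
    intro t ht
    have h1 : ContDiffAt ℝ ∞ (fun a => fderiv ℝ (fibreDeriv f) a (β, 0)) (b, v + t • w) :=
      ((hf _ (hmem t)).fibreDeriv.fderiv_right (by simp)).clm_apply contDiffAt_const
    have h0 : HasDerivAt (fun t : ℝ => fderiv ℝ (fibreDeriv f) (b, v + t • w) (β, 0))
        (fibreDeriv (fun a => fderiv ℝ (fibreDeriv f) a (β, 0)) (b, v + t • w) w) t :=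
      h1.hasDerivAt_fibre_line
    have h2 := h0.clm_apply (hasDerivAt_const t w)
    rw [fibreDeriv_apply, ← fderiv_fibreDeriv_apply (hf _ (hmem t)).fibreDeriv] at h2
    have h3 := fderiv_hessian_apply_ker hD hf hd (hmem t) (β, 0) (hseg t ht) (hseg t ht)
    simpa [h3] using h2
  have hconst : ∀ t ∈ Icc (0 : ℝ) 1, fderiv ℝ (fibreDeriv f) (b, v + t • w) (β, 0) w =
      fderiv ℝ (fibreDeriv f) (b, v) (β, 0) w := by
    intro t ht
    have h := constant_of_has_deriv_right_zero (a := (0 : ℝ)) (b := 1)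
      (fun t ht => (hh t ht).continuousAt.continuousWithinAt)
      (fun t ht => (hh t ⟨ht.1, ht.2.le⟩).hasDerivWithinAt) t ht
    simpa using h
  set κ := fderiv ℝ (fibreDeriv f) (b, v) (β, 0) w with hκ
  have hk : ∀ t : ℝ, HasDerivAt (fun t : ℝ => fderiv ℝ f (b, v + t • w) (β, 0) - t * κ)
      (fderiv ℝ (fibreDeriv f) (b, v + t • w) (β, 0) w - κ) t := by
    intro t
    simpa using (hg t).fun_sub ((hasDerivAt_id t).mul_const κ)
  have h := constant_of_has_deriv_right_zero (a := (0 : ℝ)) (b := 1)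
    (fun t _ => (hk t).continuousAt.continuousWithinAt)
    (fun t ht => by
      have := (hk t).hasDerivWithinAt (s := Ici t)
      rwa [hconst t ⟨ht.1, ht.2.le⟩, sub_self] at this) 1 ⟨zero_le_one, le_rfl⟩
  simp only [one_smul, zero_smul, add_zero, one_mul, zero_mul, sub_zero] at h
  linarith

end Hessian

/-! ### Legendre maps in coordinates -/

section Coordinates

variable {n m : ℕ}

theorem fibreDeriv_single (f : JetCoord n m → ℝ) (a : JetCoord n m) (l : Fin n) (i : Fin m) :
    fibreDeriv f a (Pi.single i (Pi.single l 1)) = dVel f l i a := rfl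

theorem sum_single_eq {k₁ k₂ : ℕ} (w : Fin k₁ → Fin k₂ → ℝ) :
    w = ∑ i, ∑ l, w i l • (Pi.single i (Pi.single l 1) : Fin k₁ → Fin k₂ → ℝ) := by
  funext i l
  simp [Finset.sum_apply, Pi.single_apply, ite_apply]

theorem map_eq_sum_single {k₁ k₂ : ℕ} (A : (Fin k₁ → Fin k₂ → ℝ) →L[ℝ] ℝ)
    (w : Fin k₁ → Fin k₂ → ℝ) :
    A w = ∑ i, ∑ l, A (Pi.single i (Pi.single l 1)) * w i l := by
  conv_lhs => rw [sum_single_eq w]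
  simp only [map_sum, map_smul, smul_eq_mul, mul_comm]

theorem fibreDeriv_eq_sum_dVel (f : JetCoord n m → ℝ) (a : JetCoord n m) (w : Fin m → Fin n → ℝ) :
    fibreDeriv f a w = ∑ i, ∑ l, dVel f l i a * w i l :=
  map_eq_sum_single _ w

theorem fibreDeriv_eq_sum_dMom (h : LegCoord n m → ℝ) (a : LegCoord n m) (p : Fin n → Fin m → ℝ) :
    fibreDeriv h a p = ∑ l, ∑ i, dMom h i l a * p l i :=
  map_eq_sum_single _ p

theorem fderiv_prod_split {V W : Type*} [NormedAddCommGroup V] [NormedSpace ℝ V]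
    [NormedAddCommGroup W] [NormedSpace ℝ W] (f : V × W → ℝ) (a : V × W) (β : V) (w : W) :
    fderiv ℝ f a (β, w) = fderiv ℝ f a (β, 0) + fibreDeriv f a w := by
  rw [fibreDeriv_apply, ← map_add]
  simp

/-- The operator `d̂_λ` of the Cartan equations is the derivative along the tangent vector
`∂_λ + u^j ∂_j + w^j_μ ∂^μ_j`. -/
theorem fderiv_eq_sum_partial (f : JetCoord n m → ℝ) (a : JetCoord n m) (l : Fin n) (u : Rn m)
    (w : Fin m → Fin n → ℝ) :
    fderiv ℝ f a ((bvec l, u), w) =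
      dBase f l a + ∑ j, u j * dFib f j a + ∑ j, ∑ μ, w j μ * dVel f μ j a := by
  have hu : u = ∑ j, u j • bvec j := by
    ext k
    simp [bvec, WithLp.ofLp_sum, Pi.single_apply]
  have h2 : fderiv ℝ f a ((0, u), 0) = ∑ j, u j * dFib f j a := by
    set A : Rn m →L[ℝ] ℝ := (fderiv ℝ f a).comp ((ContinuousLinearMap.inl ℝ _ _).comp
      (ContinuousLinearMap.inr ℝ (Rn n) (Rn m))) with hA
    change A u = ∑ j, u j * A (bvec j)
    conv_lhs => rw [hu]
    simp only [map_sum, map_smul, smul_eq_mul]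
  rw [fderiv_prod_split, fibreDeriv_eq_sum_dVel, ← h2, dBase, ← map_add]
  simp [mul_comm]

/-- The coordinate expression `(x, y, v) ↦ (x, y, ∂f/∂v)` of the Legendre map of the Lagrangian
function `f`. -/
noncomputable def legendreExpr (f : JetCoord n m → ℝ) (a : JetCoord n m) : LegCoord n m :=
  (a.1, fun l i => dVel f l i a)

theorem ContDiffAt.dVel {f : JetCoord n m → ℝ} {a : JetCoord n m} (hf : ContDiffAt ℝ ∞ f a)
    (l : Fin n) (i : Fin m) : ContDiffAt ℝ ∞ (_root_.dVel f l i) a :=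
  (hf.fderiv_right (by simp)).clm_apply contDiffAt_const

theorem ContDiffAt.dMom {h : LegCoord n m → ℝ} {a : LegCoord n m} (hh : ContDiffAt ℝ ∞ h a)
    (i : Fin m) (l : Fin n) : ContDiffAt ℝ ∞ (_root_.dMom h i l) a :=
  (hh.fderiv_right (by simp)).clm_apply contDiffAt_const

theorem ContDiffAt.legendreExpr {f : JetCoord n m → ℝ} {a : JetCoord n m}
    (hf : ContDiffAt ℝ ∞ f a) : ContDiffAt ℝ ∞ (_root_.legendreExpr f) a :=
  contDiffAt_fst.prodMk (contDiffAt_pi.2 fun l => contDiffAt_pi.2 fun i => hf.dVel l i)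

theorem fderiv_legendreExpr {f : JetCoord n m → ℝ} {a : JetCoord n m} (hf : ContDiffAt ℝ ∞ f a)
    (ξ : JetCoord n m) :
    fderiv ℝ (legendreExpr f) a ξ = (ξ.1, fun l i => fderiv ℝ (dVel f l i) a ξ) := by
  have h : HasFDerivAt (legendreExpr f) ((ContinuousLinearMap.fst ℝ _ _).prod
      (ContinuousLinearMap.pi fun l => ContinuousLinearMap.pi fun i =>
        fderiv ℝ (dVel f l i) a)) a :=
    hasFDerivAt_fst.prodMk (hasFDerivAt_pi.2 fun l => hasFDerivAt_pi.2 fun i =>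
      (hf.dVel l i).hasFDerivAt_of_infty)
  rw [h.fderiv]
  rfl

theorem fderiv_dVel {f : JetCoord n m → ℝ} {a : JetCoord n m} (hf : ContDiffAt ℝ ∞ f a)
    (l : Fin n) (i : Fin m) (ξ : JetCoord n m) :
    fderiv ℝ (dVel f l i) a ξ = fderiv ℝ (fibreDeriv f) a ξ (Pi.single i (Pi.single l 1)) := by
  have h : HasFDerivAt (dVel f l i) ((ContinuousLinearMap.apply ℝ ℝ
      (Pi.single i (Pi.single l 1) : Fin m → Fin n → ℝ)).comp (fderiv ℝ (fibreDeriv f) a)) a :=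
    HasFDerivAt.comp (f := fibreDeriv f) a (ContinuousLinearMap.apply ℝ ℝ
      (Pi.single i (Pi.single l 1) : Fin m → Fin n → ℝ)).hasFDerivAt
      hf.fibreDeriv.hasFDerivAt_of_infty
  rw [h.fderiv]
  rfl

theorem hessian_eq_zero_iff {f : JetCoord n m → ℝ} {a : JetCoord n m} (hf : ContDiffAt ℝ ∞ f a)
    (w : Fin m → Fin n → ℝ) : fibreDeriv (fibreDeriv f) a w = 0 ↔
      ∀ l i, fderiv ℝ (dVel f l i) a (0, w) = 0 := by
  constructor
  · intro h l i
    rw [fderiv_dVel hf, ← fibreDeriv_apply, h]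
    rfl
  · intro h
    ext u
    rw [map_eq_sum_single]
    refine Finset.sum_eq_zero fun i _ => Finset.sum_eq_zero fun l _ => ?_
    rw [fibreDeriv_apply, ← fderiv_dVel hf, h, zero_mul]

/-- The kernels of the tangent map of the Legendre map and of the Hessian have the same
dimension. -/
theorem finrank_ker_fderiv_legendreExpr {f : JetCoord n m → ℝ} {a : JetCoord n m}
    (hf : ContDiffAt ℝ ∞ f a) :
    Module.finrank ℝ (fderiv ℝ (legendreExpr f) a).ker =
      Module.finrank ℝ (fibreDeriv (fibreDeriv f) a).ker := by
  have h : (fderiv ℝ (legendreExpr f) a).ker = (fibreDeriv (fibreDeriv f) a).ker.map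
      (LinearMap.inr ℝ (Rn n × Rn m) (Fin m → Fin n → ℝ)) := by
    ext ξ
    rw [Submodule.mem_map]
    change fderiv ℝ (legendreExpr f) a ξ = 0 ↔ _
    rw [fderiv_legendreExpr hf]
    constructor
    · intro h0
      have h1 : ξ.1 = 0 := congrArg Prod.fst h0
      have h3 : ξ = (0, ξ.2) := Prod.ext h1 rfl
      refine ⟨ξ.2, (hessian_eq_zero_iff hf _).2 fun l i => ?_, h3.symm⟩
      have h2 := congrFun (congrFun (congrArg Prod.snd h0) l) i
      rw [← h3]
      exact h2
    · rintro ⟨w, hw, rfl⟩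
      have h1 := (hessian_eq_zero_iff hf w).1 hw
      exact Prod.ext rfl (funext fun l => funext fun i => h1 l i)
  rw [h]
  exact (Submodule.equivMapOfInjective _ LinearMap.inr_injective _).finrank_eq.symm

/-- If `𝓗 = p · ∂𝓗/∂p - 𝓛(x, y, ∂𝓗/∂p)` holds on the image of the Legendre map and the velocity
`V = ∂𝓗/∂p` at the image of `a` has the same momenta as `a`, then there the derivatives of `𝓗` with
respect to `(x, y)` are opposite to those of `𝓛` at `V`. -/
theorem fderiv_base_hamiltonian {f : JetCoord n m → ℝ} {h : LegCoord n m → ℝ}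
    {D : Set (JetCoord n m)} (hD : IsOpen D) {a : JetCoord n m} (ha : a ∈ D)
    (hf : ContDiffAt ℝ ∞ f a) (hh : ContDiffAt ℝ ∞ h (legendreExpr f a))
    (hfh : ∀ a ∈ D, h (legendreExpr f a) =
      (∑ l, ∑ i, dVel f l i a * dMom h i l (legendreExpr f a)) -
        f (a.1, fun i l => dMom h i l (legendreExpr f a)))
    (hfV : ContDiffAt ℝ ∞ f (a.1, fun i l => dMom h i l (legendreExpr f a)))
    (hV : ∀ l i, dVel f l i (a.1, fun i l => dMom h i l (legendreExpr f a)) = dVel f l i a)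
    (β : Rn n × Rn m) :
    fderiv ℝ h (legendreExpr f a) (β, 0) =
      -fderiv ℝ f (a.1, fun i l => dMom h i l (legendreExpr f a)) (β, 0) := by
  set V : JetCoord n m → Fin m → Fin n → ℝ := fun a i l => dMom h i l (legendreExpr f a) with hVdef
  have hΦ := hf.legendreExpr.hasFDerivAt_of_infty
  have hVil : ∀ i l, HasFDerivAt (fun a => V a i l) (fderiv ℝ (fun a => V a i l) a) a := fun i l =>
    ((hh.dMom i l).comp a hf.legendreExpr :
      ContDiffAt ℝ ∞ (fun a => V a i l) a).hasFDerivAt_of_infty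
  have h1 : HasFDerivAt (fun a => h (legendreExpr f a))
      ((fderiv ℝ h (legendreExpr f a)).comp (fderiv ℝ (legendreExpr f) a)) a :=
    hh.hasFDerivAt_of_infty.comp a hΦ
  have h2 : HasFDerivAt (fun a : JetCoord n m => f (a.1, V a))
      ((fderiv ℝ f (a.1, V a)).comp ((ContinuousLinearMap.fst ℝ _ _).prod
        (ContinuousLinearMap.pi fun i => ContinuousLinearMap.pi fun l =>
          fderiv ℝ (fun a => V a i l) a))) a :=
    HasFDerivAt.comp (f := fun a : JetCoord n m => (a.1, V a)) a hfV.hasFDerivAt_of_infty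
      (hasFDerivAt_fst.prodMk (hasFDerivAt_pi.2 fun i => hasFDerivAt_pi.2 fun l => hVil i l))
  have h3 : HasFDerivAt (fun a => ∑ l, ∑ i, dVel f l i a * V a i l)
      (∑ l, ∑ i, (dVel f l i a • fderiv ℝ (fun a => V a i l) a +
        V a i l • fderiv ℝ (dVel f l i) a)) a :=
    HasFDerivAt.fun_sum fun l _ => HasFDerivAt.fun_sum fun i _ =>
      (hf.dVel l i).hasFDerivAt_of_infty.mul (hVil i l)
  have h4 := h1.unique ((h3.fun_sub h2).congr_of_eventuallyEq (by
    filter_upwards [hD.mem_nhds ha] with b hb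
    exact hfh b hb))
  have h5 := DFunLike.congr_fun h4 ((β, 0) : JetCoord n m)
  simp only [ContinuousLinearMap.comp_apply, sub_apply, sum_apply, add_apply, smul_apply,
    smul_eq_mul] at h5
  rw [fderiv_legendreExpr hf, fderiv_prod_split, fibreDeriv_eq_sum_dMom] at h5
  change _ = _ - fderiv ℝ f (a.1, V a)
    (β, fun i l => fderiv ℝ (fun a => V a i l) a (β, 0)) at h5
  rw [fderiv_prod_split f, fibreDeriv_eq_sum_dVel] at h5
  have hV' : ∀ l i, dVel f l i (a.1, V a) = dVel f l i a := hV
  simp only [hV', Finset.sum_add_distrib] at h5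
  rw [Finset.sum_comm (f := fun (i : Fin m) (l : Fin n) => dVel f l i a * _)] at h5
  change _ + ∑ l, ∑ i, V a i l * _ = _ at h5
  linarith

end Coordinates

/-! ### The Legendre map in a chart -/

theorem finrank_ker_of_comp_eq {V₁ V₂ V₃ : Type*} [NormedAddCommGroup V₁] [NormedSpace ℝ V₁]
    [FiniteDimensional ℝ V₁] [NormedAddCommGroup V₂] [NormedSpace ℝ V₂] [NormedAddCommGroup V₃]
    [NormedSpace ℝ V₃] {D : V₁ →L[ℝ] V₃} (A : V₂ →L[ℝ] V₃) (S : V₁ →L[ℝ] V₂)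
    (hD : A.comp S = D) (hA : Function.Injective A) (hS : Function.Surjective S) :
    Module.finrank ℝ D.ker = Module.finrank ℝ V₁ - Module.finrank ℝ V₂ := by
  subst hD
  have hker : (A.comp S).ker = S.ker := by
    ext ξ
    change A (S ξ) = 0 ↔ S ξ = 0
    exact ⟨fun h => hA (h.trans (map_zero A).symm), fun h => by rw [h, map_zero]⟩
  have hrank := LinearMap.finrank_range_add_finrank_ker (S : V₁ →ₗ[ℝ] V₂)
  rw [LinearMap.range_eq_top.2 hS, finrank_top] at hrank
  rw [hker]
  exact (Nat.sub_eq_of_eq_add' hrank.symm).symm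

section Geometry

variable {n m : ℕ} {X Y : Type*} [TopologicalSpace X] [ChartedSpace (Rn n) X]
  [TopologicalSpace Y] [ChartedSpace (Rn n × Rn m) Y] {π : Y → X}

namespace FibredChart

variable (c : FibredChart n m π)

theorem isOpen_jetDom : IsOpen c.jetDom := c.total.open_target.prod isOpen_univ

theorem isOpen_legDom : IsOpen c.legDom := c.total.open_target.prod isOpen_univ

theorem exists_jetCoord (hπ : ContMDiff 𝓘(ℝ, Rn n × Rn m) 𝓘(ℝ, Rn n) ∞ π) {a : JetCoord n m}
    (ha : a ∈ c.jetDom) : ∃ z : Jet1 n m π, z.pt ∈ c.total.source ∧ c.jetCoord z = a := by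
  have hy : c.total.symm a.1 ∈ c.total.source := c.total.map_target ha.1
  refine ⟨⟨c.total.symm a.1, c.jetOf hπ hy a.2⟩, hy, ?_⟩
  rw [jetCoord, c.vel_jetOf hπ hy, c.total.right_inv ha.1]

end FibredChart

namespace Lagrangian

variable (L : Lagrangian n m π) (c : FibredChart n m π)

theorem contDiffAt_loc {a : JetCoord n m} (ha : a ∈ c.jetDom) : ContDiffAt ℝ ∞ (L.loc c) a :=
  (L.loc_contDiffOn c).contDiffAt (c.isOpen_jetDom.mem_nhds ha)

theorem legCoord_legendre (hπ : ContMDiff 𝓘(ℝ, Rn n × Rn m) 𝓘(ℝ, Rn n) ∞ π)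
    {z : Jet1 n m π} (hz : z.pt ∈ c.total.source) :
    c.legCoord (L.legendre z) = legendreExpr (L.loc c) (c.jetCoord z) :=
  Prod.ext rfl (funext fun l => funext fun i => L.momenta_legendre hπ c z hz l i)

end Lagrangian

/-- The Hessian of an almost regular Lagrangian has constant rank in each chart: the Legendre map
is a submersion onto `N_L` followed by an immersion. -/
theorem AlmostRegular.exists_finrank_ker_hessian {L : Lagrangian n m π} (hL : AlmostRegular L)
    (hπ : ContMDiff 𝓘(ℝ, Rn n × Rn m) 𝓘(ℝ, Rn n) ∞ π) (c : FibredChart n m π) :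
    ∃ d : ℕ, ∀ a ∈ c.jetDom,
      Module.finrank ℝ (fibreDeriv (fibreDeriv (L.loc c)) a).ker = d := by
  obtain ⟨k, F, tF, cF, cN, mF, mN, -, himm, hsub⟩ := hL.fibred
  obtain ⟨g, hg, hgs, hgsurj⟩ := hsub c
  obtain ⟨his, hiinj⟩ := himm c
  refine ⟨Module.finrank ℝ (JetCoord n m) - Module.finrank ℝ ((Rn n × Rn m) × Rn k),
    fun a ha => ?_⟩
  have hpt : ∀ b ∈ c.jetDom, (g b).1.pt ∈ c.total.source ∧
      c.legCoord (g b).1 = legendreExpr (L.loc c) b := by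
    intro b hb
    obtain ⟨z, hz, rfl⟩ := c.exists_jetCoord hπ hb
    rw [hg z hz]
    exact ⟨hz, L.legCoord_legendre c hπ hz⟩
  have hopen : IsOpen {q : L.Constraint | q.1.pt ∈ c.total.source} := by
    have h1 : IsOpen {q : Legendre n m π | q.pt ∈ c.total.source ∧ c.legCoord q ∈ univ} :=
      TopologicalSpace.isOpen_generateFrom_of_mem ⟨c, univ, isOpen_univ, rfl⟩
    simpa using h1.preimage continuous_subtype_val
  have hg' : HasMFDerivAt 𝓘(ℝ, JetCoord n m) 𝓘(ℝ, (Rn n × Rn m) × Rn k) g a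
      (mfderiv 𝓘(ℝ, JetCoord n m) 𝓘(ℝ, (Rn n × Rn m) × Rn k) g a) :=
    ((hgs.contMDiffAt (c.isOpen_jetDom.mem_nhds ha)).mdifferentiableAt (by simp)).hasMFDerivAt
  have hi' : HasMFDerivAt 𝓘(ℝ, (Rn n × Rn m) × Rn k) 𝓘(ℝ, LegCoord n m)
      (fun q : L.Constraint => c.legCoord q.1) (g a)
      (mfderiv 𝓘(ℝ, (Rn n × Rn m) × Rn k) 𝓘(ℝ, LegCoord n m)
        (fun q : L.Constraint => c.legCoord q.1) (g a)) :=
    ((his.contMDiffAt (hopen.mem_nhds (hpt a ha).1)).mdifferentiableAt (by simp)).hasMFDerivAt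
  have hcomp := HasMFDerivAt.comp a hi' hg'
  have hΦ : HasMFDerivAt 𝓘(ℝ, JetCoord n m) 𝓘(ℝ, LegCoord n m) (legendreExpr (L.loc c)) a
      (fderiv ℝ (legendreExpr (L.loc c)) a) :=
    (L.contDiffAt_loc c ha).legendreExpr.hasFDerivAt_of_infty.hasMFDerivAt
  have heq := hasMFDerivAt_unique (hcomp.congr_of_eventuallyEq (by
    filter_upwards [c.isOpen_jetDom.mem_nhds ha] with b hb
    exact (hpt b hb).2.symm)) hΦ
  rw [← finrank_ker_fderiv_legendreExpr (L.contDiffAt_loc c ha)]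
  exact finrank_ker_of_comp_eq (V₁ := JetCoord n m) (V₂ := (Rn n × Rn m) × Rn k)
    (V₃ := LegCoord n m) _ _ heq (hiinj (g a) (hpt a ha).1) (hgsurj a ha)

/-- In coordinates, weak association is the equality `𝓗 = p · ∂𝓗/∂p - 𝓛(x, y, ∂𝓗/∂p)` on the
image of the Legendre map. -/
theorem WeaklyAssociated.ham_legendreExpr [IsManifold 𝓘(ℝ, Rn n) ∞ X]
    [IsManifold 𝓘(ℝ, Rn n × Rn m) ∞ Y] {T : Type*} [TopologicalSpace T] [ChartedSpace (Rn m) T]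
    [IsManifold 𝓘(ℝ, Rn m) ∞ T] {hπ : IsSmoothFibreBundle (Rn n) (Rn m) T π}
    {L : Lagrangian n m π} {H : HamiltonianForm n m π} (hH : WeaklyAssociated L H hπ)
    (c : FibredChart n m π) {a : JetCoord n m} (ha : a ∈ c.jetDom) :
    H.ham c (legendreExpr (L.loc c) a) =
      (∑ l, ∑ i, dVel (L.loc c) l i a * dMom (H.ham c) i l (legendreExpr (L.loc c) a)) -
        L.loc c (a.1, fun i l => dMom (H.ham c) i l (legendreExpr (L.loc c) a)) := by
  obtain ⟨z, hz, rfl⟩ := c.exists_jetCoord hπ.smooth ha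
  set q := L.legendre z with hq
  have hqz : q.pt ∈ c.total.source := hz
  set σ := H.hamJet hπ q with hσ
  have h1 := hH q ⟨z, rfl⟩ c hqz (fun k => σ.lin (c.baseFrame (π q.pt) k))
  have h2 : (fun k => dproj n m π q.pt (σ.lin (c.baseFrame (π q.pt) k))) =
      c.baseFrame (π q.pt) := funext fun k => σ.split _
  have h3 := L.loc_jetCoord c ⟨q.pt, σ⟩ hqz
  have h4 : c.vel σ = fun i l => dMom (H.ham c) i l (c.legCoord q) := H.vel_hamJet hπ c q hqz
  rw [H.toForm_eq c q hqz, FibredChart.formOfJet, c.vol_jet hπ.smooth hqz, mul_one, mul_one,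
    h2, h3, FibredChart.jetCoord, h4] at h1
  have h5 : ∀ l i, c.momenta q.mom l i = dVel (L.loc c) l i (c.jetCoord z) :=
    L.momenta_legendre hπ.smooth c z hz
  simp only [h5] at h1
  rw [L.legCoord_legendre c hπ.smooth hz] at h1
  change _ = _ + L.loc c ((c.jetCoord z).1, _) at h1
  linarith

end Geometry

/-! ### Sections in fibred coordinates -/

section Sections

variable {n m : ℕ} {X Y : Type*} [TopologicalSpace X] [ChartedSpace (Rn n) X]
  [TopologicalSpace Y] [ChartedSpace (Rn n × Rn m) Y] {π : Y → X}

theorem tangentCast_baseFrame (c : FibredChart n m π) {x x' : X} (h : x = x') (l : Fin n) :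
    tangentCast h (c.baseFrame x l) = c.baseFrame x' l := by
  subst h
  rfl

namespace IsJetSection

variable {s : X → Jet1 n m π} (c : FibredChart n m π)

theorem isOpen_preimage (hs : IsJetSection s) : IsOpen {x | (s x).pt ∈ c.total.source} :=
  c.total.open_source.preimage hs.smooth_pt.continuous

theorem mem_base (hs : IsJetSection s) {x : X} (hx : (s x).pt ∈ c.total.source) :
    x ∈ c.base.source := by
  have h := c.proj_mem _ hx
  rwa [hs.proj_pt] at h

theorem eventually_mem (hs : IsJetSection s) {x : X} (hx : (s x).pt ∈ c.total.source) :
    ∀ᶠ ξ in 𝓝 (c.base x), ξ ∈ c.base.target ∧ (s (c.base.symm ξ)).pt ∈ c.total.source := by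
  have hb := hs.mem_base c hx
  have h1 : ContinuousAt c.base.symm (c.base x) :=
    c.base.continuousAt_symm (c.base.map_source hb)
  refine Filter.Eventually.and (c.base.open_target.mem_nhds (c.base.map_source hb)) ?_
  refine h1.eventually (p := fun x => (s x).pt ∈ c.total.source) ?_
  rw [c.base.left_inv hb]
  exact (hs.isOpen_preimage c).mem_nhds hx

/-- The coordinate expression of a section of `J¹Y → X`. -/
theorem contDiffAt_coord (hs : IsJetSection s) {x : X} (hx : (s x).pt ∈ c.total.source) :
    ContDiffAt ℝ ∞ (fun ξ => c.jetCoord (s (c.base.symm ξ))) (c.base x) := by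
  have hb := hs.mem_base c hx
  rw [← contMDiffAt_iff_contDiffAt]
  have h1 : ContMDiffAt 𝓘(ℝ, Rn n) 𝓘(ℝ, Rn n) ∞ c.base.symm (c.base x) :=
    (contMDiffOn_symm_of_mem_maximalAtlas c.base_mem).contMDiffAt
      (c.base.open_target.mem_nhds (c.base.map_source hb))
  have h2 : ContMDiffAt 𝓘(ℝ, Rn n) 𝓘(ℝ, JetCoord n m) ∞ (fun x => c.jetCoord (s x))
      (c.base.symm (c.base x)) := by
    rw [c.base.left_inv hb]
    exact (hs.smooth_coord c).contMDiffAt ((hs.isOpen_preimage c).mem_nhds hx)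
  exact h2.comp (c.base x) h1

/-- The base coordinates of the tangent vectors `∂_λ s` are those of `∂_λ`. -/
theorem fderiv_coord_base (hs : IsJetSection s) {x : X} (hx : (s x).pt ∈ c.total.source)
    (v : Rn n) :
    (fderiv ℝ (fun ξ => c.jetCoord (s (c.base.symm ξ))) (c.base x) v).1.1 = v := by
  have h1 := (hs.contDiffAt_coord c hx).hasFDerivAt_of_infty.fst.fst
  have h2 : HasFDerivAt (fun ξ => (c.jetCoord (s (c.base.symm ξ))).1.1)
      (ContinuousLinearMap.id ℝ (Rn n)) (c.base x) := by
    refine (hasFDerivAt_id _).congr_of_eventuallyEq ?_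
    filter_upwards [hs.eventually_mem c hx] with ξ hξ
    change (c.total (s (c.base.symm ξ)).pt).1 = ξ
    rw [← c.proj_eq _ hξ.2, hs.proj_pt, c.base.right_inv hξ.1]
  exact DFunLike.congr_fun (h1.unique h2) v

/-- The jet coordinates of the prolongation of `π¹₀ ∘ s` are the partial derivatives `∂_λ s^i`. -/
theorem vel_prolong (hs : IsJetSection s) (hπ : ContMDiff 𝓘(ℝ, Rn n × Rn m) 𝓘(ℝ, Rn n) ∞ π) {x : X}
    (hx : (s x).pt ∈ c.total.source) (i : Fin m) (l : Fin n) :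
    c.vel (prolong hπ (fun x => (s x).pt) hs.smooth_pt hs.proj_pt x).jet i l =
      (fderiv ℝ (fun ξ => c.jetCoord (s (c.base.symm ξ))) (c.base x) (bvec l)).1.2 i := by
  have hb := hs.mem_base c hx
  set D := fderiv ℝ (fun ξ => c.jetCoord (s (c.base.symm ξ))) (c.base x)
  have h1 : HasMFDerivAt 𝓘(ℝ, Rn n) 𝓘(ℝ, Rn n × Rn m) (c.total ∘ fun x => (s x).pt) x
      ((c.dY (s x).pt).comp (mfderiv 𝓘(ℝ, Rn n) 𝓘(ℝ, Rn n × Rn m) (fun x => (s x).pt) x)) := by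
    refine HasMFDerivAt.comp x ?_ (hs.smooth_pt.mdifferentiable (by simp) x).hasMFDerivAt
    exact ((contMDiffAt_of_mem_maximalAtlas c.total_mem hx).mdifferentiableAt
      (by simp)).hasMFDerivAt
  have h2 : HasMFDerivAt 𝓘(ℝ, Rn n) 𝓘(ℝ, Rn n × Rn m)
      ((fun ξ => (c.jetCoord (s (c.base.symm ξ))).1) ∘ c.base) x
      (((ContinuousLinearMap.fst ℝ (Rn n × Rn m) (Fin m → Fin n → ℝ)).comp D).comp (c.dX x)) := by
    refine HasMFDerivAt.comp (I' := 𝓘(ℝ, Rn n)) x ?_ ?_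
    · exact (hs.contDiffAt_coord c hx).hasFDerivAt_of_infty.fst.hasMFDerivAt
    · exact ((contMDiffAt_of_mem_maximalAtlas c.base_mem hb).mdifferentiableAt
        (by simp)).hasMFDerivAt
  have h3 := hasMFDerivAt_unique h1 (h2.congr_of_eventuallyEq (by
    filter_upwards [c.base.open_source.mem_nhds hb] with x' hx'
    simp only [Function.comp_apply, c.base.left_inv hx']
    rfl))
  have h4 := DFunLike.congr_fun h3 (c.baseFrame x l)
  have h5 : c.dX x (c.baseFrame x l) = bvec l := c.dX_baseFrame hb l
  change c.dY (s x).pt (mfderiv 𝓘(ℝ, Rn n) 𝓘(ℝ, Rn n × Rn m) (fun x => (s x).pt) x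
    (c.baseFrame x l)) = (D (c.dX x (c.baseFrame x l))).1 at h4
  rw [h5] at h4
  change (c.dY (s x).pt (mfderiv 𝓘(ℝ, Rn n) 𝓘(ℝ, Rn n × Rn m) (fun x => (s x).pt) x
    (tangentCast (hs.proj_pt x) (c.baseFrame (π (s x).pt) l)))).2 i = _
  rw [tangentCast_baseFrame, h4]

end IsJetSection

end Sections

/-! ### The Hamilton equations -/

/-- The Legendre map takes smooth sections of `J¹Y → X` to smooth sections of `Π → X`. -/
theorem IsJetSection.legendre {n m : ℕ} {X Y : Type*} [TopologicalSpace X] [ChartedSpace (Rn n) X]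
    [TopologicalSpace Y] [ChartedSpace (Rn n × Rn m) Y] {π : Y → X}
    (hπ : ContMDiff 𝓘(ℝ, Rn n × Rn m) 𝓘(ℝ, Rn n) ∞ π) (L : Lagrangian n m π) {s : X → Jet1 n m π}
    (hs : IsJetSection s) : IsLegSection (fun x => L.legendre (s x)) := by
  refine ⟨hs.proj_pt, hs.smooth_pt, fun c => ?_⟩
  have h1 : ContMDiffOn 𝓘(ℝ, JetCoord n m) 𝓘(ℝ, LegCoord n m) ∞ (legendreExpr (L.loc c))
      c.jetDom := by
    rw [contMDiffOn_iff_contDiffOn]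
    exact fun a ha => (L.contDiffAt_loc c ha).legendreExpr.contDiffWithinAt
  refine (h1.comp (hs.smooth_coord c) ?_).congr ?_
  · intro x hx
    exact ⟨c.total.map_source hx, mem_univ _⟩
  · intro x hx
    exact L.legCoord_legendre c hπ hx

theorem theorem4 {n m : ℕ} {X Y T : Type*}
    [TopologicalSpace X] [T2Space X] [SecondCountableTopology X] [ConnectedSpace X]
    [ChartedSpace (Rn n) X] [IsManifold 𝓘(ℝ, Rn n) ∞ X]
    [TopologicalSpace Y] [T2Space Y] [SecondCountableTopology Y] [ConnectedSpace Y]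
    [ChartedSpace (Rn n × Rn m) Y] [IsManifold 𝓘(ℝ, Rn n × Rn m) ∞ Y]
    [TopologicalSpace T] [ChartedSpace (Rn m) T] [IsManifold 𝓘(ℝ, Rn m) ∞ T]
    (π : Y → X) (hπ : IsSmoothFibreBundle (Rn n) (Rn m) T π)
    (L : Lagrangian n m π) (hL : AlmostRegular L)
    (s : X → Jet1 n m π) (hs : IsCartanSolution L s)
    (H : HamiltonianForm n m π) (hH : WeaklyAssociated L H hπ)
    (hHs : ∀ x, H.hamMap hπ (L.legendre (s x)) =
      prolong hπ.smooth (fun x => (s x).pt) hs.isSection.smooth_pt hs.isSection.proj_pt x) :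
    IsHamiltonSolution H (fun x => L.legendre (s x)) := by
  have hsec := hs.isSection
  -- The coordinate expression of `L̂ ∘ s̄` and its tangent vectors.
  have hD : ∀ (c : FibredChart n m π) (x : X), (s x).pt ∈ c.total.source → ∀ v : Rn n,
      fderiv ℝ (fun ξ => c.legCoord (L.legendre (s (c.base.symm ξ)))) (c.base x) v =
        fderiv ℝ (legendreExpr (L.loc c)) (c.jetCoord (s x))
          (fderiv ℝ (fun ξ => c.jetCoord (s (c.base.symm ξ))) (c.base x) v) := by
    intro c x hx v
    have hx0 : c.base.symm (c.base x) = x := c.base.left_inv (hsec.mem_base c hx)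
    have ha : c.jetCoord (s x) ∈ c.jetDom := ⟨c.total.map_source hx, mem_univ _⟩
    have h1 : HasFDerivAt (legendreExpr (L.loc c))
        (fderiv ℝ (legendreExpr (L.loc c)) (c.jetCoord (s x)))
        (c.jetCoord (s (c.base.symm (c.base x)))) := by
      rw [hx0]
      exact (L.contDiffAt_loc c ha).legendreExpr.hasFDerivAt_of_infty
    have h2 := HasFDerivAt.comp (f := fun ξ => c.jetCoord (s (c.base.symm ξ))) (c.base x) h1
      (hsec.contDiffAt_coord c hx).hasFDerivAt_of_infty
    have h3 := h2.congr_of_eventuallyEq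
      (f₁ := fun ξ => c.legCoord (L.legendre (s (c.base.symm ξ)))) (by
        filter_upwards [hsec.eventually_mem c hx] with ξ hξ
        exact L.legCoord_legendre c hπ.smooth hξ.2)
    rw [h3.fderiv]
    rfl
  -- `Ĥ ∘ L̂ ∘ s̄ = J¹(π¹₀ ∘ s̄)` in coordinates.
  have hV : ∀ (c : FibredChart n m π) (x : X), (s x).pt ∈ c.total.source → ∀ i l,
      dMom (H.ham c) i l (legendreExpr (L.loc c) (c.jetCoord (s x))) =
        (fderiv ℝ (fun ξ => c.jetCoord (s (c.base.symm ξ))) (c.base x) (bvec l)).1.2 i := by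
    intro c x hx i l
    have h1 := congrArg (fun z => (c.jetCoord z).2 i l) (hHs x)
    change c.vel (H.hamJet hπ (L.legendre (s x))) i l = c.vel (prolong hπ.smooth
      (fun x => (s x).pt) hs.isSection.smooth_pt hs.isSection.proj_pt x).jet i l at h1
    rw [H.vel_hamJet hπ c (L.legendre (s x)) hx, hsec.vel_prolong c hπ.smooth hx,
      L.legCoord_legendre c hπ.smooth hx] at h1
    exact h1
  refine ⟨hsec.legendre hπ.smooth L, ?_, ?_⟩
  · intro c x hx a D l i
    have hx' : (s x).pt ∈ c.total.source := hx
    have ha : c.jetCoord (s x) ∈ c.jetDom := ⟨c.total.map_source hx', mem_univ _⟩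
    have haeq : a = legendreExpr (L.loc c) (c.jetCoord (s x)) := L.legCoord_legendre c hπ.smooth hx'
    have hDl : D l = _ := hD c x hx' (bvec l)
    rw [haeq, hV c x hx' i l, hDl, fderiv_legendreExpr (L.contDiffAt_loc c ha)]
  · intro c x hx a' D' i
    have hx' : (s x).pt ∈ c.total.source := hx
    have haeq : a' = legendreExpr (L.loc c) (c.jetCoord (s x)) :=
      L.legCoord_legendre c hπ.smooth hx'
    have hvel := hs.vel_eq c x hx'
    have hfield := hs.field_eq c x hx' i
    have hDbase := fun l => hsec.fderiv_coord_base c hx' (bvec l)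
    have hVx := hV c x hx'
    have hD' : ∀ l, D' l = _ := fun l => hD c x hx' (bvec l)
    have ha : c.jetCoord (s x) ∈ c.jetDom := ⟨c.total.map_source hx', mem_univ _⟩
    obtain ⟨d, hd⟩ := hL.exists_finrank_ker_hessian hπ.smooth c
    have hh : ∀ p ∈ c.legDom, ContDiffAt ℝ ∞ (H.ham c) p := fun p hp =>
      (H.ham_contDiffOn c).contDiffAt (c.isOpen_legDom.mem_nhds hp)
    have hloc : ∀ a ∈ c.jetDom, ContDiffAt ℝ ∞ (L.loc c) a := fun a => L.contDiffAt_loc c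
    dsimp only at hvel hfield
    set f := L.loc c with hf
    set a := c.jetCoord (s x) with hadef
    set D := fderiv ℝ (fun ξ => c.jetCoord (s (c.base.symm ξ))) (c.base x) with hDdef
    have hfa := hloc a ha
    set w : Fin m → Fin n → ℝ := fun j μ => (D (bvec μ)).1.2 j - a.2 j μ with hw
    have hvw : a.2 + w = fun j μ => dMom (H.ham c) j μ (legendreExpr f a) := by
      funext j μ
      rw [hVx j μ]
      simp [hw]
    -- The first Cartan equation: `ŷ - y` lies in the kernel of the Hessian.
    have hker : fibreDeriv (fibreDeriv f) (a.1, a.2) w = 0 := by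
      rw [hessian_eq_zero_iff hfa]
      intro l i
      rw [fderiv_dVel hfa, ← fibreDeriv_apply, fibreDeriv_fibreDeriv_symm hfa, map_eq_sum_single]
      rw [← hvel l i]
      refine Finset.sum_congr rfl fun j _ => Finset.sum_congr rfl fun μ _ => ?_
      rw [← fibreDeriv_single (dVel f μ j) a l i, fibreDeriv_apply (dVel f μ j), fderiv_dVel hfa]
      rfl
    have hb : a.1 ∈ c.total.target := ha.1
    have hP := fibreDeriv_add_ker c.total.open_target hloc hd hb hker
    have hbase := fderiv_base_add_ker c.total.open_target hloc hd hb hker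
      ((0, bvec i) : Rn n × Rn m)
    rw [hvw] at hP hbase
    -- `ŷ` and the velocities of `s̄(x)` have the same momenta.
    have hmomV : ∀ l i, dVel f l i (a.1, fun j μ => dMom (H.ham c) j μ (legendreExpr f a)) =
        dVel f l i a := by
      intro l i
      rw [← fibreDeriv_single, hP]
      rfl
    have hham := fderiv_base_hamiltonian (h := H.ham c) c.isOpen_jetDom ha hfa
      (hh _ ⟨hb, mem_univ _⟩) (fun a ha => hH.ham_legendreExpr c ha) (hloc _ ⟨hb, mem_univ _⟩)
      hmomV (0, bvec i)
    -- The mixed term `(ŷ^j_λ - y^j_λ) ∂_i π^λ_j` of the second Cartan equation.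
    have hmix : fderiv ℝ (fibreDeriv f) a ((0, bvec i), 0) w =
        ∑ l, ∑ j, w j l * dFib (dVel f l j) i a := by
      rw [map_eq_sum_single, Finset.sum_comm]
      refine Finset.sum_congr rfl fun l _ => Finset.sum_congr rfl fun j _ => ?_
      rw [dFib, fderiv_dVel hfa, mul_comm]
    have hdhat : ∀ l, fderiv ℝ (dVel f l i) a (D (bvec l)) =
        dBase (dVel f l i) l a + ∑ j, (D (bvec l)).1.2 j * dFib (dVel f l i) j a +
          ∑ j, ∑ μ, (D (bvec l)).2 j μ * dVel (dVel f l i) μ j a := by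
      intro l
      rw [← fderiv_eq_sum_partial]
      exact congrArg _ (Prod.ext (Prod.ext (hDbase l) rfl) rfl)
    have hmom : ∀ l, (D' l).2 l i = fderiv ℝ (dVel f l i) a (D (bvec l)) := by
      intro l
      rw [hD' l, fderiv_legendreExpr hfa]
    simp only [hmom, haeq]
    change _ = -fderiv ℝ (H.ham c) (legendreExpr f a) ((0, bvec i), 0)
    rw [hham, hbase, hmix, neg_neg]
    simp only [← hdhat] at hfield
    change dFib f i a - _ + _ = 0 at hfield
    change _ = dFib f i a + _
    linarith
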